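/- **Conventions.** For a semigroup $S$, $S^1$ is $S$ with an identity adjoined. For $x,y\in S$ and $z_1,z_2,\dots\in S^1$ put $\lambda_0=x$, $\rho_0=y$, $\lambda_{n+1}=\lambda_n z_{n+1}\rho_n$, $\rho_{n+1}=\rho_n z_{n+1}\lambda_n$; here $\lambda_n=\lambda_n(x,y,z_1,\dots,z_n)$ and $\rho_n=\rho_n(x,y,z_1,\dots,z_n)$. $S$ is *nilpotent* (in the sense of Mal'cev) if for some $n\ge 1$ one has $\lambda_n(a,b,c_1,\dots,c_n)=\rho_n(a,b,c_1,\dots,c_n)$ for all $a,b\in S$ and $c_1,\dots,c_n\in S^1$. The *upper non-nilpotent graph* $\mathcal N_S$ has vertex set $S$, with an edge between $x$ and $y$ if $\langle x,y\rangle$ is not nilpotent. The empty set counts as an ideal, $S/I$ is the Rees factor semigroup, and $S/\emptyset=S$. $S$ is *pseudo-nilpotent* if, whenever $x,y\in S$, $w_1,\dots,w_m\in S^1$, $I$ is a (possibly empty) ideal of $T=\langle x,y,w_1,\dots,w_m\rangle$, $0\le t<m$, $\lambda_m,\rho_m\notin I$, $\lambda_t\neq\rho_t$ and $(\lambda_t,\rho_t)=(\lambda_m,\rho_m)$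 (with $\lambda_i=\lambda_i(x,y,w_1,\dots,w_i)$ and $\rho_i=\rho_i(x,y,w_1,\dots,w_i)$), there is an edge in $\mathcal N_{T/I}$ between $\lambda_i$ and $\rho_i$ for every $0\le i\le m$. Let $S$ be a finite semigroup with a principal series $S=S_1\supset S_2\supset\dots\supset S_m\supset S_{m+1}=\emptyset$, i.e. a strictly decreasing chain of ideals with no ideal strictly between consecutive terms. Put $$F_i=\{s\in S\setminus S_i : sj\notin S_{i+1}\text{ or }js\notin S_{i+1}\text{ for some }j\in S_i\},$$ and let $S^{(i)}$ be the union of all $S_j\setminus S_{j+1}$ with $j\le i$ and $S_j\setminus S_{j+1}\subseteq F_i\cup(S_i\setminus S_{i+1})$. The set $S_i\setminus S_{i+1}$ is a *root* if $S_i/S_{i+1}$ is not nilpotent and $\mathcal N_S$ has no edge between an element of $S_i\setminus S_{i+1}$ and an element of $S_{i+1}$; then $S^{(i)}$ is called its *stem*. A *connection* between two distinct stems $S^{(i)}$ and $S^{(j)}$ is a set $S_k\setminus S_{k+1}\subseteq S^{(i)}\cap S^{(j)}$. If $S$ is pseudo-nilpotent and $S_i\setminus S_{i+1}$ is a root, write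 $(S_i/S_{i+1})^0=\mathcal M^0(G,I,\Lambda;P)$, a regular Rees matrix semigroup over a group $G$ with elements $(g;e,f)$. The *pseudo-nilpotent homomorphism* $\Phi_i:(S/S_{i+1})^0\to(I\times\Lambda)^0$ sends $a\in F_i\cup(S_i\setminus S_{i+1})$ to the unique pair $(e,f)$ such that, in $\mathcal N_{S/S_{i+1}}$, $a$ is adjacent to no $(g;e,f)$ with $g\in G$ and to every $(g;e',f')$ with $g\in G$ and $(e',f')\ne(e,f)$; it sends all other elements to the zero. Its fibres are its *pseudo-nilpotent classes*. $S$ is *strong pseudo-nilpotent* (with respect to the given principal series) if it is pseudo-nilpotent and * (H1) whenever $S_k\setminus S_{k+1}$ is a connection between stems $S^{(i_1)}$ and $S^{(i_2)}$, it intersects two different pseudo-nilpotent classes of $\Phi_{i_1}$ and also two different pseudo-nilpotent classes of $\Phi_{i_2}$; * (H2) whenever $i<j$ and $\mathcal N_S$ has an edge between an element of $S_i\setminus S_{i+1}$ and an element of $S_j\setminus S_{j+1}$, one has $S_i\setminus S_{i+1}\subseteq F_j$. **Lemma.** Let $S$ be a strong pseudo-nilpotent finite semigroup. 1. Let $S^{(i_1)},S^{(i_2)},S^{(i_3)}$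 be stems with $S^{(i_1)}\ne S^{(i_3)}$. If there is a connection between $S^{(i_1)}$ and $S^{(i_2)}$ and a connection between $S^{(i_2)}$ and $S^{(i_3)}$, then there is a connection between $S^{(i_1)}$ and $S^{(i_3)}$. 2. If there is no connection between two distinct stems $S^{(i)}$ and $S^{(j)}$, then these stems belong to different connected components of $\mathcal N_S$: there are connected components $C\neq D$ of $\mathcal N_S$ with $S^{(i)}\subseteq C$ and $S^{(j)}\subseteq D$. -/

import Mathlib

universe u

/-! ### Mal'cev nilpotency -/

/-- The product `a z b` of `S`, where `z` is an element of `S¹` (the semigroup `S` with an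
identity adjoined). -/
def sandwichMul {S : Type u} [Semigroup S] (a : S) (z : WithOne S) (b : S) : S :=
  WithOne.recOneCoe (a * b) (fun c => a * c * b) z

theorem coe_sandwichMul {S : Type u} [Semigroup S] (a : S) (z : WithOne S) (b : S) :
    ((sandwichMul a z b : S) : WithOne S) = (a : WithOne S) * z * (b : WithOne S) := by
  cases z <;> simp [sandwichMul]

/-- The pair `(λₙ, ρₙ)` built from `x`, `y` and `z₁, z₂, …` (here `z 0, z 1, …`):
`λ₀ = x`, `ρ₀ = y`, `λₙ₊₁ = λₙ zₙ₊₁ ρₙ`, `ρₙ₊₁ = ρₙ zₙ₊₁ λₙ`. It depends only on the first `n`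
terms of `z`. -/
def malcevPair {S : Type u} [Semigroup S] (x y : S) (z : ℕ → WithOne S) : ℕ → S × S
  | 0 => (x, y)
  | n + 1 =>
    (sandwichMul (malcevPair x y z n).1 (z n) (malcevPair x y z n).2,
     sandwichMul (malcevPair x y z n).2 (z n) (malcevPair x y z n).1)

/-- Nilpotency of a semigroup in the sense of Mal'cev. -/
def MalcevNilpotent (S : Type u) [Semigroup S] : Prop :=
  ∃ n : ℕ, 0 < n ∧ ∀ (a b : S) (c : ℕ → WithOne S),
    (malcevPair a b c n).1 = (malcevPair a b c n).2

/-- The upper non-nilpotent graph `𝒩_S`: `x` and `y` are adjacent when the subsemigroup `⟨x, y⟩`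
is not nilpotent. (A monogenic semigroup is commutative, hence nilpotent, so that asking for
`x ≠ y` discards nothing.) -/
def upperNonNilpotentGraph (S : Type u) [Semigroup S] : SimpleGraph S where
  Adj x y := x ≠ y ∧ ¬ MalcevNilpotent (Subsemigroup.closure ({x, y} : Set S))
  symm := ⟨fun x y h => ⟨h.1.symm, by rw [Set.pair_comm]; exact h.2⟩⟩
  loopless := ⟨fun _ h => h.1 rfl⟩

/-! ### Ideals and Rees factor semigroups -/

/-- A two-sided ideal of a semigroup; the empty set counts as an ideal. -/
structure SgIdeal (S : Type u) [Semigroup S] where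
  carrier : Set S
  mul_mem_left : ∀ (s : S) {a : S}, a ∈ carrier → s * a ∈ carrier
  mul_mem_right : ∀ (s : S) {a : S}, a ∈ carrier → a * s ∈ carrier

namespace SgIdeal

/-- An ideal, as a subsemigroup. -/
def toSubsemigroup {S : Type u} [Semigroup S] (J : SgIdeal S) : Subsemigroup S where
  carrier := J.carrier
  mul_mem' := fun {a _} _ hb => J.mul_mem_left a hb

/-- The ideal `A ∩ T` of a subsemigroup `T`. -/
def restrict {S : Type u} [Semigroup S] (A : SgIdeal S) (T : Subsemigroup S) : SgIdeal T where
  carrier := {t | (t : S) ∈ A.carrier}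
  mul_mem_left := fun s _ ha => A.mul_mem_left (s : S) ha
  mul_mem_right := fun s _ ha => A.mul_mem_right (s : S) ha

/-- The Rees congruence of an ideal: `I` is collapsed to one point (and to nothing if `I = ∅`). -/
def reesCon {S : Type u} [Semigroup S] (I : SgIdeal S) : Con S where
  r a b := a = b ∨ (a ∈ I.carrier ∧ b ∈ I.carrier)
  iseqv :=
    { refl := fun _ => Or.inl rfl
      symm := by
        rintro a b (h | h)
        · exact Or.inl h.symm
        · exact Or.inr ⟨h.2, h.1⟩
      trans := by
        rintro a b c (rfl | h) (rfl | h')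
        · exact Or.inl rfl
        · exact Or.inr h'
        · exact Or.inr h
        · exact Or.inr ⟨h.1, h'.2⟩ }
  mul' := by
    rintro a b c d (rfl | h) (rfl | h')
    · exact Or.inl rfl
    · exact Or.inr ⟨I.mul_mem_left _ h'.1, I.mul_mem_left _ h'.2⟩
    · exact Or.inr ⟨I.mul_mem_right _ h.1, I.mul_mem_right _ h.2⟩
    · exact Or.inr ⟨I.mul_mem_left _ h'.1, I.mul_mem_left _ h'.2⟩

/-- The Rees factor semigroup `S / I`; in particular `S / ∅ = S`. -/
abbrev ReesFactor {S : Type u} [Semigroup S] (I : SgIdeal S) : Type u := I.reesCon.Quotient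

/-- The class of `a` in `S / I`. -/
def toFactor {S : Type u} [Semigroup S] (I : SgIdeal S) (a : S) : I.ReesFactor :=
  (a : I.reesCon.Quotient)

end SgIdeal

/-! ### Pseudo-nilpotent semigroups -/

/-- Pseudo-nilpotent semigroups. The subsemigroup `T` is `⟨x, y, w₁, …, w_m⟩` (those `wᵢ` that are
the adjoined identity contribute no generator), and `I` is a possibly empty ideal of `T`. -/
def PseudoNilpotent (S : Type u) [Semigroup S] : Prop :=
  ∀ (T : Subsemigroup S) (x y : T) (t m : ℕ) (w : ℕ → WithOne T) (I : SgIdeal T),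
    t < m →
    Subsemigroup.closure ({x, y} ∪ {s : T | ∃ k < m, w k = (s : WithOne T)}) = ⊤ →
    (malcevPair x y w m).1 ∉ I.carrier →
    (malcevPair x y w m).2 ∉ I.carrier →
    (malcevPair x y w t).1 ≠ (malcevPair x y w t).2 →
    malcevPair x y w t = malcevPair x y w m →
    ∀ i ≤ m, (upperNonNilpotentGraph I.ReesFactor).Adj
      (I.toFactor (malcevPair x y w i).1) (I.toFactor (malcevPair x y w i).2)

/-! ### Principal series, roots, stems and connections -/

/-- A principal series `S = S₀ ⊃ S₁ ⊃ ⋯ ⊃ S_m = ∅`: a strictly decreasing chain of ideals such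
that no ideal lies strictly between two consecutive terms. -/
structure PrincipalSeries (S : Type u) [Semigroup S] where
  length : ℕ
  ideal : Fin (length + 1) → SgIdeal S
  first : (ideal 0).carrier = Set.univ
  last : (ideal (Fin.last length)).carrier = ∅
  ssubset : ∀ i : Fin length, (ideal i.succ).carrier ⊂ (ideal i.castSucc).carrier
  maximal : ∀ (i : Fin length) (J : SgIdeal S), (ideal i.succ).carrier ⊆ J.carrier →
    J.carrier ⊆ (ideal i.castSucc).carrier →
    J.carrier = (ideal i.succ).carrier ∨ J.carrier = (ideal i.castSucc).carrier

namespace PrincipalSeries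

variable {S : Type u} [Semigroup S] (P : PrincipalSeries S)

/-- The ideal `Sᵢ`. -/
def upper (i : Fin P.length) : SgIdeal S := P.ideal i.castSucc

/-- The ideal `Sᵢ₊₁`. -/
def lower (i : Fin P.length) : SgIdeal S := P.ideal i.succ

/-- The set `Sᵢ \ Sᵢ₊₁`. -/
def layer (i : Fin P.length) : Set S := (P.upper i).carrier \ (P.lower i).carrier

/-- The principal factor `Sᵢ / Sᵢ₊₁`. -/
abbrev Factor (i : Fin P.length) : Type u :=
  ((P.lower i).restrict (P.upper i).toSubsemigroup).ReesFactor

/-- The set `F_J(T) = {s ∈ T \ J | s j ≠ θ or j s ≠ θ for some j ∈ J}` for `T = (S / Sᵢ₊₁)⁰` and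
`J = (Sᵢ / Sᵢ₊₁)⁰`, where the elements of `S \ Sᵢ₊₁` are identified with the nonzero elements
of `T`. -/
def F (i : Fin P.length) : Set S :=
  {s | s ∉ (P.upper i).carrier ∧
    ∃ j ∈ (P.upper i).carrier, s * j ∉ (P.lower i).carrier ∨ j * s ∉ (P.lower i).carrier}

/-- `Sᵢ \ Sᵢ₊₁` is a root. -/
def IsRoot (i : Fin P.length) : Prop :=
  ¬ MalcevNilpotent (P.Factor i) ∧
    ∀ a ∈ P.layer i, ∀ b ∈ (P.lower i).carrier, ¬ (upperNonNilpotentGraph S).Adj a b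

/-- The set `S⁽ⁱ⁾`, the union of the sets `Sⱼ \ Sⱼ₊₁` with `j ≤ i` that are contained in
`F ∪ (Sᵢ \ Sᵢ₊₁)`. It is called the stem of `Sᵢ \ Sᵢ₊₁` when the latter is a root. -/
def stem (i : Fin P.length) : Set S :=
  ⋃ j ∈ {j : Fin P.length | j ≤ i ∧ P.layer j ⊆ P.F i ∪ P.layer i}, P.layer j

/-- `S_k \ S_{k+1}` is a connection between the two distinct stems `S⁽ⁱ⁾` and `S⁽ʲ⁾`. -/
def IsConnection (i j k : Fin P.length) : Prop :=
  P.IsRoot i ∧ P.IsRoot j ∧ P.stem i ≠ P.stem j ∧ P.layer k ⊆ P.stem i ∩ P.stem j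

/-- There is a connection between the stems `S⁽ⁱ⁾` and `S⁽ʲ⁾`. -/
def HasConnection (i j : Fin P.length) : Prop := ∃ k, P.IsConnection i j k

/-! ### Pseudo-nilpotent homomorphisms and strong pseudo-nilpotent semigroups -/

/-- An identification of `(Sᵢ / Sᵢ₊₁)⁰` with a regular Rees matrix semigroup `ℳ⁰(G, I, Λ; p)`:
the nonzero elements `(g; k, l)` correspond to the elements of `Sᵢ \ Sᵢ₊₁`, and
`(g; k, l) (g'; k', l') = (g p_{l k'} g'; k, l')`, which is zero when `p_{l k'}` is zero. -/
structure ReesCoordinates (i : Fin P.length) (G I Λ : Type u) [Group G] where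
  p : Λ → I → WithZero G
  elt : G × I × Λ ≃ P.layer i
  mul_of_zero : ∀ (g g' : G) (k k' : I) (l l' : Λ), p l k' = 0 →
    (elt (g, k, l) : S) * (elt (g', k', l') : S) ∈ (P.lower i).carrier
  mul_of_coe : ∀ (g g' h : G) (k k' : I) (l l' : Λ), p l k' = (h : WithZero G) →
    (elt (g, k, l) : S) * (elt (g', k', l') : S) = (elt (g * h * g', k, l') : S)
  row_regular : ∀ l, ∃ k, p l k ≠ 0
  col_regular : ∀ k, ∃ l, p l k ≠ 0

/-- `Φ` is the pseudo-nilpotent homomorphism `(S / Sᵢ₊₁)⁰ → (I × Λ)⁰` (written as a map on `S`,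
where `Sᵢ₊₁` stands for the zero). For `a ∈ F ∪ (Sᵢ \ Sᵢ₊₁)`, `Φ a` is the pair `(e, f)` such that
in the graph of `S / Sᵢ₊₁` the element `a` is adjacent to no `(g; e, f)` and is adjacent to all
other nonzero elements of `Sᵢ / Sᵢ₊₁`; and `Φ a = θ` for all other `a`. -/
def IsPseudoNilpotentHom {i : Fin P.length} {G I Λ : Type u} [Group G]
    (c : P.ReesCoordinates i G I Λ) (Φ : S → WithZero (I × Λ)) : Prop :=
  (∀ a ∈ P.F i ∪ P.layer i, ∃ (e : I) (f : Λ), Φ a = ((e, f) : I × Λ) ∧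
    ∀ (g : G) (k : I) (l : Λ),
      (upperNonNilpotentGraph (P.lower i).ReesFactor).Adj
        ((P.lower i).toFactor a) ((P.lower i).toFactor (c.elt (g, k, l) : S)) ↔ (k, l) ≠ (e, f)) ∧
  ∀ a ∉ P.F i ∪ P.layer i, Φ a = 0

/-- `S_k \ S_{k+1}` intersects two different pseudo-nilpotent classes (fibres) of the
pseudo-nilpotent homomorphism with domain `(S / Sᵢ₊₁)⁰`. -/
def MeetsTwoClasses (i k : Fin P.length) : Prop :=
  ∀ (G I Λ : Type u) [Group G] (c : P.ReesCoordinates i G I Λ) (Φ : S → WithZero (I × Λ)),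
    P.IsPseudoNilpotentHom c Φ → ∃ a ∈ P.layer k, ∃ b ∈ P.layer k, Φ a ≠ Φ b

/-- Strong pseudo-nilpotent semigroups, with respect to a principal series: pseudo-nilpotent
semigroups with the properties (H1) and (H2). -/
structure IsStrongPseudoNilpotent : Prop where
  pseudoNilpotent : PseudoNilpotent S
  h1 : ∀ i₁ i₂ k : Fin P.length, P.IsConnection i₁ i₂ k →
    P.MeetsTwoClasses i₁ k ∧ P.MeetsTwoClasses i₂ k
  h2 : ∀ i j : Fin P.length, i < j →
    (∃ a ∈ P.layer i, ∃ b ∈ P.layer j, (upperNonNilpotentGraph S).Adj a b) →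
    P.layer i ⊆ P.F j

end PrincipalSeries

/-! ### Functoriality of the Mal'cev words -/

/-! Call a set of pairs of distinct elements persistent if each pair (a, b) in it has a successor (a
w b, b w a) in it. In a finite semigroup, non-nilpotency yields a nonempty persistent set.
Conversely, iterating successors must repeat a pair, so pseudo-nilpotency turns the pairs of a
persistent set into edges, also modulo an ideal that the set avoids. Two facts restrict these edges:
elements adjacent modulo J have product outside J (`mul_notMem_of_adj`), and commuting elements are
never adjacent (`not_adj_of_commute`).

Layers of the principal series are 𝒥-classes of S¹. By the two facts, a layer containing a
persistent set is closed under products and is not a single ℋ-class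
(`IsJClass.mul_mem_of_persistent`); such a layer is called thick. An element a above a thick layer
K, that is, dividing an element of K, acts on the ℛ-classes of K from the left and on the ℒ-classes
from the right. Elements acting differently form persistent pairs, so commuting elements act alike.
Comparing a with an idempotent power, and that with an element of K, shows that a acts by constants
(`IsClosedJClass.rRel_mul_mul`). The constant ℛ-class and ℒ-class are the value of the
pseudo-nilpotent homomorphism, and elements with different values are adjacent.

Roots are thick, and the stem of a root is exactly the set of elements above it. Every edge joins
two elements above some thick layer, and descending along edges from a thick layer reaches a root;
so every edge lies inside one stem (`exists_isRoot_of_adj`), and every stem lies in one component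
(`IsThick.reachable`).

For part 1, let layers k and k' connect the stems 1, 2 and 2, 3. By (H1), k meets two classes of the
middle homomorphism, so some element of k is adjacent to one of k'. If k ≠ k', (H2) then places the
earlier layer above the later one, hence in both outer stems. For part 2, a path between two stems
is covered by successively intersecting stems, and by part 1 intersection is transitive among stems
of roots. -/

theorem map_sandwichMul {S T : Type*} [Semigroup S] [Semigroup T] (f : S →ₙ* T) (a : S)
    (z : WithOne S) (b : S) :
    f (sandwichMul a z b) = sandwichMul (f a) (WithOne.mapMulHom f z) (f b) := by
  cases z <;> simp [sandwichMul]

theorem map_malcevPair {S T : Type*} [Semigroup S] [Semigroup T] (f : S →ₙ* T) (x y : S)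
    (z : ℕ → WithOne S) (n : ℕ) :
    malcevPair (f x) (f y) (fun k => WithOne.mapMulHom f (z k)) n =
      (f (malcevPair x y z n).1, f (malcevPair x y z n).2) := by
  induction n with
  | zero => rfl
  | succ n ih => simp [malcevPair, ih, map_sandwichMul]

theorem malcevPair_congr {S : Type*} [Semigroup S] (x y : S) {z z' : ℕ → WithOne S} (n : ℕ)
    (h : ∀ k < n, z k = z' k) : malcevPair x y z n = malcevPair x y z' n := by
  induction n with
  | zero => rfl
  | succ n ih => simp [malcevPair, ih fun k hk => h k (hk.trans n.lt_succ_self), h n n.lt_succ_self]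

theorem malcevPair_succ' {S : Type*} [Semigroup S] (x y : S) (z : ℕ → WithOne S) (n : ℕ) :
    malcevPair x y z (n + 1) =
      malcevPair (sandwichMul x (z 0) y) (sandwichMul y (z 0) x) (fun k => z (k + 1)) n := by
  induction n with
  | zero => rfl
  | succ n ih => rw [malcevPair, ih]; rfl

theorem WithOne.mapMulHom_surjective {S T : Type*} [Mul S] [Mul T] {f : S →ₙ* T}
    (hf : Function.Surjective f) : Function.Surjective (WithOne.mapMulHom f) := by
  intro z
  cases z with
  | one => exact ⟨1, map_one _⟩
  | coe a => obtain ⟨b, rfl⟩ := hf a; exact ⟨b, WithOne.mapMulHom_coe f b⟩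

theorem map_malcevPair_eq_of_le {S T : Type*} [Semigroup S] [Semigroup T] (f : S →ₙ* T) (x y : S)
    (z : ℕ → WithOne S) {n k : ℕ} (hnk : n ≤ k)
    (h : f (malcevPair x y z n).1 = f (malcevPair x y z n).2) :
    f (malcevPair x y z k).1 = f (malcevPair x y z k).2 := by
  induction k, hnk using Nat.le_induction with
  | base => exact h
  | succ k _ ih => simp [malcevPair, map_sandwichMul, ih]

theorem malcevNilpotent_iff_of_surjective {S T : Type*} [Semigroup S] [Semigroup T] (f : S →ₙ* T)
    (hf : Function.Surjective f) :
    MalcevNilpotent T ↔ ∃ n : ℕ, 0 < n ∧ ∀ (a b : S) (c : ℕ → WithOne S),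
      f (malcevPair a b c n).1 = f (malcevPair a b c n).2 := by
  refine exists_congr fun n => and_congr_right fun _ => ⟨fun h a b c => ?_, fun h a b c => ?_⟩
  · simpa [map_malcevPair] using h (f a) (f b) (fun k => WithOne.mapMulHom f (c k))
  · obtain ⟨a, rfl⟩ := hf a
    obtain ⟨b, rfl⟩ := hf b
    choose c' hc' using fun k => WithOne.mapMulHom_surjective hf (c k)
    obtain rfl : (fun k => WithOne.mapMulHom f (c' k)) = c := funext hc'
    simpa [map_malcevPair] using h a b c'

/-- The restriction of a homomorphism to the subsemigroup generated by two elements. -/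
def closurePairMap {S T : Type*} [Semigroup S] [Semigroup T] (f : S →ₙ* T) (x y : S) :
    Subsemigroup.closure ({x, y} : Set S) →ₙ* Subsemigroup.closure ({f x, f y} : Set T) :=
  (f.comp (MulMemClass.subtype _)).codRestrict _ fun a => by
    have h := Subsemigroup.mem_map_of_mem f a.2
    rwa [MulHom.map_mclosure, Set.image_pair] at h

theorem closurePairMap_surjective {S T : Type*} [Semigroup S] [Semigroup T] (f : S →ₙ* T)
    (x y : S) : Function.Surjective (closurePairMap f x y) := by
  rintro ⟨b, hb⟩
  have hb' := hb
  rw [← Set.image_pair, ← MulHom.map_mclosure] at hb'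
  obtain ⟨a, ha, rfl⟩ := hb'
  exact ⟨⟨a, ha⟩, rfl⟩

theorem upperNonNilpotentGraph_adj_map_iff {S T : Type*} [Semigroup S] [Semigroup T] (f : S →ₙ* T)
    (x y : S) : (upperNonNilpotentGraph T).Adj (f x) (f y) ↔ f x ≠ f y ∧
      ¬ ∃ n : ℕ, 0 < n ∧ ∀ (a b : Subsemigroup.closure ({x, y} : Set S)) (c : ℕ → WithOne _),
        f (malcevPair a b c n).1 = f (malcevPair a b c n).2 := by
  refine and_congr_right fun _ => not_congr ?_
  rw [malcevNilpotent_iff_of_surjective _ (closurePairMap_surjective f x y)]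
  simp only [Subtype.ext_iff]
  rfl

/-- Adjacency of images depends only on words in the source modulo the kernel of the homomorphism.
This compares S/∅ with S, and the factor of a subsemigroup T by J ∩ T with S/J. -/
theorem upperNonNilpotentGraph_adj_congr {R S T : Type*} [Semigroup R] [Semigroup S] [Semigroup T]
    (f : R →ₙ* S) (g : R →ₙ* T) (hfg : ∀ a b, f a = f b ↔ g a = g b) (x y : R) :
    (upperNonNilpotentGraph S).Adj (f x) (f y) ↔ (upperNonNilpotentGraph T).Adj (g x) (g y) := by
  simp only [upperNonNilpotentGraph_adj_map_iff, ne_eq, hfg]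

/-! ### Persistent sets of pairs -/

/-- A set `Q` of pairs of distinct elements of a monoid is persistent (relative to `W`) if every
pair `(a, b)` in `Q` has a successor `(a w b, b w a)` in `Q`, for some `w ∈ W`. -/
def Persistent {M : Type*} [Monoid M] (W : Set M) (Q : Set (M × M)) : Prop :=
  ∀ p ∈ Q, p.1 ≠ p.2 ∧ ∃ w ∈ W, (p.1 * w * p.2, p.2 * w * p.1) ∈ Q

theorem Persistent.mono {M : Type*} [Monoid M] {W W' : Set M} {Q : Set (M × M)} (hW : W ⊆ W')
    (h : Persistent W Q) : Persistent W' Q := fun p hp =>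
  ⟨(h p hp).1, let ⟨w, hw, h'⟩ := (h p hp).2; ⟨w, hW hw, h'⟩⟩

/-! ### Rees quotient maps and edges in Rees factors -/

namespace SgIdeal

/-- The Rees quotient map. -/
def reesMk {S : Type u} [Semigroup S] (J : SgIdeal S) : S →ₙ* J.ReesFactor where
  toFun := J.toFactor
  map_mul' _ _ := rfl

theorem reesMk_eq_iff {S : Type u} [Semigroup S] (J : SgIdeal S) {a b : S} :
    J.reesMk a = J.reesMk b ↔ a = b ∨ (a ∈ J.carrier ∧ b ∈ J.carrier) :=
  Con.eq J.reesCon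

theorem reesMk_surjective {S : Type u} [Semigroup S] (J : SgIdeal S) : Function.Surjective J.reesMk :=
  Quotient.mk_surjective

/-- The empty ideal. -/
def empty (S : Type u) [Semigroup S] : SgIdeal S where
  carrier := ∅
  mul_mem_left _ _ h := h.elim
  mul_mem_right _ _ h := h.elim

theorem adj_mk_empty_iff {S : Type u} [Semigroup S] (x y : S) :
    (upperNonNilpotentGraph (empty S).ReesFactor).Adj ((empty S).toFactor x) ((empty S).toFactor y)
      ↔ (upperNonNilpotentGraph S).Adj x y :=
  upperNonNilpotentGraph_adj_congr (empty S).reesMk (MulHom.id S)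
    (fun a b => by rw [reesMk_eq_iff]; simp [empty]) x y

theorem adj_restrict_iff {S : Type u} [Semigroup S] (J : SgIdeal S) (T : Subsemigroup S) (x y : T) :
    (upperNonNilpotentGraph (J.restrict T).ReesFactor).Adj ((J.restrict T).toFactor x)
      ((J.restrict T).toFactor y)
      ↔ (upperNonNilpotentGraph J.ReesFactor).Adj (J.toFactor x) (J.toFactor y) :=
  upperNonNilpotentGraph_adj_congr (J.restrict T).reesMk (J.reesMk.comp (MulMemClass.subtype T))
    (fun a b => by
      rw [reesMk_eq_iff]
      change _ ↔ J.reesMk (a : S) = J.reesMk (b : S)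
      rw [reesMk_eq_iff, Subtype.ext_iff]
      rfl) x y

end SgIdeal

/-! ### Passage between persistent sets and edges -/

theorem Persistent.exists_malcevPair {S : Type u} [Semigroup S] {W : Set (WithOne S)}
    {Q : Set (WithOne S × WithOne S)} (hQ : Persistent W Q) {x y : S}
    (hxy : ((x : WithOne S), (y : WithOne S)) ∈ Q) :
    ∃ z : ℕ → WithOne S, (∀ n, z n ∈ W) ∧ ∀ n, (((malcevPair x y z n).1 : WithOne S),
      ((malcevPair x y z n).2 : WithOne S)) ∈ Q := by
  have h : ∀ p : {p : S × S // ((p.1 : WithOne S), (p.2 : WithOne S)) ∈ Q}, ∃ w ∈ W,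
      (((sandwichMul p.1.1 w p.1.2 : S) : WithOne S),
        ((sandwichMul p.1.2 w p.1.1 : S) : WithOne S)) ∈ Q := by
    rintro ⟨p, hp⟩
    obtain ⟨w, hw, h⟩ := (hQ _ hp).2
    exact ⟨w, hw, by simpa only [coe_sandwichMul] using h⟩
  choose f hfW hf using h
  let st : ℕ → {p : S × S // ((p.1 : WithOne S), (p.2 : WithOne S)) ∈ Q} := fun n =>
    Nat.rec ⟨(x, y), hxy⟩ (fun _ p =>
      ⟨(sandwichMul p.1.1 (f p) p.1.2, sandwichMul p.1.2 (f p) p.1.1), hf p⟩) n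
  have key : ∀ n, malcevPair x y (fun n => f (st n)) n = (st n).1 := by
    intro n
    induction n with
    | zero => rfl
    | succ n ih => rw [malcevPair, ih]
  exact ⟨fun n => f (st n), fun n => hfW _, fun n => by rw [key]; exact (st n).2⟩

/-- In a finite pseudo-nilpotent semigroup the pairs of a persistent set that avoids an ideal `J`
are adjacent modulo `J`. -/
theorem PseudoNilpotent.adj_toFactor {S : Type u} [Semigroup S] [Finite S] (h : PseudoNilpotent S)
    (J : SgIdeal S) {W : Set (WithOne S)} {Q : Set (WithOne S × WithOne S)} (hQ : Persistent W Q)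
    (hJ : ∀ a b : S, ((a : WithOne S), (b : WithOne S)) ∈ Q → a ∉ J.carrier ∧ b ∉ J.carrier)
    {x y : S} (hxy : ((x : WithOne S), (y : WithOne S)) ∈ Q) :
    (upperNonNilpotentGraph J.ReesFactor).Adj (J.toFactor x) (J.toFactor y) := by
  obtain ⟨z, -, hz⟩ := hQ.exists_malcevPair hxy
  -- The orbit of (x, y) moves in a finite set, so it repeats; this supplies the indices t < m of
  -- pseudo-nilpotency.
  obtain ⟨t, m, htm, hpair⟩ : ∃ t m, t < m ∧ malcevPair x y z t = malcevPair x y z m := by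
    obtain ⟨t, m, hne, heq⟩ := Finite.exists_ne_map_eq_of_infinite (malcevPair x y z)
    rcases hne.lt_or_gt with hlt | hlt
    exacts [⟨t, m, hlt, heq⟩, ⟨m, t, hlt, heq.symm⟩]
  -- Only the connectors used before time m may generate T; the later ones do not matter and are
  -- replaced by 1 below.
  let A : Set S := {x, y} ∪ {s : S | ∃ k < m, z k = (s : WithOne S)}
  let T := Subsemigroup.closure A
  have hAT : A ⊆ T := Subsemigroup.subset_closure
  have hx : x ∈ T := hAT (by simp [A])
  have hy : y ∈ T := hAT (by simp [A])
  have hlift : ∀ k, ∃ w : WithOne T, k < m →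
      WithOne.mapMulHom (MulMemClass.subtype T) w = z k := by
    intro k
    by_cases hk : k < m
    · rcases hzk : z k with _ | s
      · exact ⟨1, fun _ => map_one _⟩
      · exact ⟨((⟨s, hAT (Or.inr ⟨k, hk, hzk⟩)⟩ : T) : WithOne T), fun _ => rfl⟩
    · exact ⟨1, fun h => (hk h).elim⟩
  choose w hw using hlift
  have hmal : ∀ n ≤ m, ((malcevPair (⟨x, hx⟩ : T) ⟨y, hy⟩ w n).1 : S) = (malcevPair x y z n).1 ∧
      ((malcevPair (⟨x, hx⟩ : T) ⟨y, hy⟩ w n).2 : S) = (malcevPair x y z n).2 := by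
    intro n hn
    have h1 := map_malcevPair (MulMemClass.subtype T) ⟨x, hx⟩ ⟨y, hy⟩ w n
    rw [malcevPair_congr _ _ n fun k hk => hw k (hk.trans_le hn)] at h1
    exact ⟨(congrArg Prod.fst h1).symm, (congrArg Prod.snd h1).symm⟩
  have hmemJ := fun n => hJ _ _ (hz n)
  have hcl : Subsemigroup.closure ({⟨x, hx⟩, ⟨y, hy⟩} ∪ {s : T | ∃ k < m, w k = (s : WithOne T)})
      = ⊤ := by
    rw [← Subsemigroup.closure_closure_coe_preimage (s := A)]
    congr 1
    ext s
    simp only [A, Set.mem_union, Set.mem_insert_iff, Set.mem_singleton_iff, Set.mem_ofPred_eq,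
      Set.mem_preimage, Subtype.ext_iff]
    refine or_congr_right (exists_congr fun k => and_congr_right fun hk => ?_)
    rw [← hw k hk]
    have hinj := WithOne.mapMulHom_injective (f := MulMemClass.subtype T) Subtype.val_injective
    rw [← hinj.eq_iff]
    rfl
  have := h T ⟨x, hx⟩ ⟨y, hy⟩ t m w (J.restrict T) htm hcl
    (fun hm => (hmemJ m).1 (by rw [← (hmal m le_rfl).1]; exact hm))
    (fun hm => (hmemJ m).2 (by rw [← (hmal m le_rfl).2]; exact hm))
    (fun he => (hQ _ (hz t)).1 (by
      change ((malcevPair x y z t).1 : WithOne S) = ((malcevPair x y z t).2 : WithOne S)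
      rw [← (hmal t htm.le).1, ← (hmal t htm.le).2, he]))
    (Prod.ext
      (Subtype.ext (by rw [(hmal t htm.le).1, (hmal m le_rfl).1, hpair]))
      (Subtype.ext (by rw [(hmal t htm.le).2, (hmal m le_rfl).2, hpair])))
    0 m.zero_le
  exact (J.adj_restrict_iff T _ _).1 this

theorem PseudoNilpotent.adj {S : Type u} [Semigroup S] [Finite S] (h : PseudoNilpotent S)
    {W : Set (WithOne S)} {Q : Set (WithOne S × WithOne S)} (hQ : Persistent W Q)
    {x y : S} (hxy : ((x : WithOne S), (y : WithOne S)) ∈ Q) :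
    (upperNonNilpotentGraph S).Adj x y :=
  (SgIdeal.adj_mk_empty_iff x y).1
    (h.adj_toFactor (SgIdeal.empty S) hQ (fun _ _ _ => ⟨id, id⟩) hxy)

/-- A finite semigroup with a non-nilpotent image contains a set of pairs with different images
in which every pair has a successor. -/
theorem exists_persistent_of_surjective {C : Type*} {U : Type*} [Semigroup C] [Semigroup U]
    [Finite C] (f : C →ₙ* U) (hf : Function.Surjective f) (hU : ¬ MalcevNilpotent U) :
    ∃ Q : Set (C × C), Q.Nonempty ∧ ∀ p ∈ Q, f p.1 ≠ f p.2 ∧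
      ∃ w : WithOne C, (sandwichMul p.1 w p.2, sandwichMul p.2 w p.1) ∈ Q := by
  rw [malcevNilpotent_iff_of_surjective f hf] at hU
  -- These are the pairs that can be kept apart under f for every length n. If there were none, or
  -- if one had no successor among them, finiteness would give a uniform bound B on the lengths.
  refine ⟨{p | ∀ n, ∃ c : ℕ → WithOne C,
    f (malcevPair p.1 p.2 c n).1 ≠ f (malcevPair p.1 p.2 c n).2}, ?_, fun p hp => ⟨?_, ?_⟩⟩
  · by_contra hne
    rw [Set.not_nonempty_iff_eq_empty, Set.eq_empty_iff_forall_notMem] at hne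
    simp only [Set.mem_ofPred_eq, not_forall, not_exists, not_not] at hne
    choose N hN using hne
    obtain ⟨B, hB⟩ := (Set.finite_range N).bddAbove
    refine hU ⟨B + 1, B.succ_pos, fun a b c => ?_⟩
    exact map_malcevPair_eq_of_le f a b c ((hB ⟨(a, b), rfl⟩).trans B.le_succ) (hN (a, b) c)
  · obtain ⟨c, hc⟩ := hp 0
    exact hc
  · by_contra! hne
    simp only [Set.mem_ofPred_eq, not_forall, not_exists, not_not] at hne
    choose N hN using hne
    have : Finite (WithOne C) := inferInstanceAs (Finite (Option C))
    obtain ⟨B, hB⟩ := (Set.finite_range N).bddAbove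
    obtain ⟨c, hc⟩ := hp (B + 1)
    rw [malcevPair_succ'] at hc
    exact hc (map_malcevPair_eq_of_le f _ _ _ (hB ⟨c 0, rfl⟩) (hN (c 0) _))

/-- Avoiding J costs nothing: a component in J would put both components of the successor in J,
where f identifies them. -/
theorem exists_persistent_of_not_malcevNilpotent {S : Type u} [Semigroup S] [Finite S]
    (C : Subsemigroup S) (J : SgIdeal S) {U : Type*} [Semigroup U] (f : C →ₙ* U)
    (hf : Function.Surjective f)
    (hfJ : ∀ a b : C, (a : S) ∈ J.carrier → (b : S) ∈ J.carrier → f a = f b)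
    (hU : ¬ MalcevNilpotent U) :
    ∃ Q : Set (WithOne S × WithOne S), Q.Nonempty ∧
      Persistent (insert 1 ((↑) '' (C : Set S))) Q ∧
      ∀ p ∈ Q, p.1 ∈ ((↑) '' ((C : Set S) \ J.carrier) : Set (WithOne S)) ∧
        p.2 ∈ ((↑) '' ((C : Set S) \ J.carrier) : Set (WithOne S)) := by
  obtain ⟨Q, hne, hQ⟩ := exists_persistent_of_surjective f hf hU
  refine ⟨(fun p : C × C => (((p.1 : S) : WithOne S), ((p.2 : S) : WithOne S))) '' Q,
    hne.image _, ?_, ?_⟩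
  · rintro _ ⟨p, hp, rfl⟩
    obtain ⟨h1, w, hw⟩ := hQ p hp
    refine ⟨fun h => h1 (congrArg f (Subtype.ext (WithOne.coe_injective h))),
      WithOne.mapMulHom (MulMemClass.subtype C) w, ?_, _, hw, ?_⟩
    · cases w with
      | one => exact Or.inl (map_one _)
      | coe w => exact Or.inr ⟨w, w.2, rfl⟩
    · have h2 := fun a b => map_sandwichMul (MulMemClass.subtype C) a w b
      simp only [MulMemClass.subtype_apply] at h2
      simp only [h2, coe_sandwichMul]
  · rintro _ ⟨p, hp, rfl⟩
    obtain ⟨h1, w, hw⟩ := hQ p hp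
    have h2 := (hQ _ hw).1
    have hJ : ∀ a b : C, (a : S) ∈ J.carrier →
        ((sandwichMul a w b : C) : S) ∈ J.carrier ∧ ((sandwichMul b w a : C) : S) ∈ J.carrier := by
      intro a b ha
      cases w with
      | one => exact ⟨J.mul_mem_right _ ha, J.mul_mem_left _ ha⟩
      | coe w => exact ⟨J.mul_mem_right _ (J.mul_mem_right _ ha), J.mul_mem_left _ ha⟩
    exact ⟨⟨_, ⟨p.1.2, fun h => h2 (hfJ _ _ (hJ _ _ h).1 (hJ _ _ h).2)⟩, rfl⟩,
      ⟨_, ⟨p.2.2, fun h => h2 (hfJ _ _ (hJ _ _ h).2 (hJ _ _ h).1)⟩, rfl⟩⟩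

theorem exists_persistent_of_adj {S : Type u} [Semigroup S] [Finite S] (J : SgIdeal S) {x y : S}
    (h : (upperNonNilpotentGraph J.ReesFactor).Adj (J.toFactor x) (J.toFactor y)) :
    ∃ Q : Set (WithOne S × WithOne S), Q.Nonempty ∧
      Persistent (insert 1 ((↑) '' (Subsemigroup.closure ({x, y} : Set S) : Set S))) Q ∧
      ∀ p ∈ Q,
        p.1 ∈ ((↑) '' ((Subsemigroup.closure ({x, y} : Set S) : Set S) \ J.carrier) :
          Set (WithOne S)) ∧
        p.2 ∈ ((↑) '' ((Subsemigroup.closure ({x, y} : Set S) : Set S) \ J.carrier) :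
          Set (WithOne S)) :=
  exists_persistent_of_not_malcevNilpotent _ J (closurePairMap J.reesMk x y)
    (closurePairMap_surjective _ _ _)
    (fun _ _ ha hb => Subtype.ext (J.reesMk_eq_iff.2 (Or.inr ⟨ha, hb⟩))) h.2

/-! ### Green's relations in a finite monoid -/

theorem finite_mulOpposite (M : Type*) [Finite M] : Finite Mᵐᵒᵖ :=
  Finite.of_injective _ MulOpposite.unop_injective

section Green

variable {M : Type*} [Monoid M]

/-- Green's relation `ℛ`. -/
def RRel (a b : M) : Prop := (∃ s, a * s = b) ∧ ∃ t, b * t = a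

/-- Green's relation `ℒ`. -/
def LRel (a b : M) : Prop := (∃ s, s * a = b) ∧ ∃ t, t * b = a

/-- `K` is a `𝒥`-class (or empty). -/
def IsJClass (K : Set M) : Prop :=
  ∀ a ∈ K, ∀ b, b ∈ K ↔ (∃ u v, u * a * v = b) ∧ ∃ u v, u * b * v = a

theorem RRel.refl (a : M) : RRel a a := ⟨⟨1, mul_one a⟩, ⟨1, mul_one a⟩⟩
theorem RRel.symm {a b : M} (h : RRel a b) : RRel b a := ⟨h.2, h.1⟩
theorem RRel.trans {a b c : M} (h : RRel a b) (h' : RRel b c) : RRel a c := by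
  obtain ⟨⟨s, rfl⟩, ⟨t, ht⟩⟩ := h
  obtain ⟨⟨s', rfl⟩, ⟨t', ht'⟩⟩ := h'
  exact ⟨⟨s * s', (mul_assoc _ _ _).symm⟩, ⟨t' * t, by rw [← mul_assoc, ht', ht]⟩⟩

theorem LRel.refl (a : M) : LRel a a := ⟨⟨1, one_mul a⟩, ⟨1, one_mul a⟩⟩
theorem LRel.symm {a b : M} (h : LRel a b) : LRel b a := ⟨h.2, h.1⟩
theorem LRel.trans {a b c : M} (h : LRel a b) (h' : LRel b c) : LRel a c := by
  obtain ⟨⟨s, rfl⟩, ⟨t, ht⟩⟩ := h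
  obtain ⟨⟨s', rfl⟩, ⟨t', ht'⟩⟩ := h'
  exact ⟨⟨s' * s, mul_assoc _ _ _⟩, ⟨t * t', by rw [mul_assoc, ht', ht]⟩⟩

open MulOpposite in
theorem rRel_op_iff {a b : M} : RRel (op a) (op b) ↔ LRel a b := by
  simp only [RRel, LRel, op_surjective.exists, ← op_mul, op_inj]

theorem exists_pow_idempotent [Finite M] (a : M) : ∃ n, 0 < n ∧ a ^ n * a ^ n = a ^ n := by
  obtain ⟨m, d, hd, h⟩ : ∃ m d, 0 < d ∧ a ^ (m + d) = a ^ m := by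
    obtain ⟨i, j, hne, heq⟩ := Finite.exists_ne_map_eq_of_infinite (fun k : ℕ => a ^ k)
    rcases hne.lt_or_gt with hlt | hlt
    · exact ⟨i, j - i, by omega, by rw [Nat.add_sub_cancel' hlt.le]; exact heq.symm⟩
    · exact ⟨j, i - j, by omega, by rw [Nat.add_sub_cancel' hlt.le]; exact heq⟩
  have h1 : ∀ k, a ^ (m + k * d) = a ^ m := by
    intro k
    induction k with
    | zero => simp
    | succ k ih => rw [show m + (k + 1) * d = (m + d) + k * d by ring, pow_add, h, ← pow_add, ih]
  -- The exponent is a positive multiple of the period d that is at least the preperiod m.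
  refine ⟨(m + 1) * d, by positivity, ?_⟩
  have hm : m ≤ (m + 1) * d := by nlinarith
  obtain ⟨r, hr⟩ := Nat.exists_eq_add_of_le hm
  have h2 : a ^ (m + (m + 1) * d) = a ^ m := h1 _
  calc a ^ ((m + 1) * d) * a ^ ((m + 1) * d) = a ^ (m + (m + 1) * d) * a ^ r := by
        nth_rewrite 2 [hr]
        rw [← pow_add, ← pow_add]
        congr 1
        ring
    _ = a ^ ((m + 1) * d) := by rw [h2, ← pow_add, ← hr]

/-- Stability of finite monoids: iterating gives u ^ n * a * (s * v) ^ n = a, and with u ^ n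
idempotent the left factor can be dropped. -/
theorem exists_mul_eq_of_mul_mul_eq [Finite M] {a s u v : M} (h : u * (a * s) * v = a) :
    ∃ t, a * s * t = a := by
  obtain ⟨n, hn, hid⟩ := exists_pow_idempotent u
  have h1 : ∀ k, u ^ k * a * (s * v) ^ k = a := by
    intro k
    induction k with
    | zero => simp
    | succ k ih =>
      calc u ^ (k + 1) * a * (s * v) ^ (k + 1) = u ^ k * (u * (a * s) * v) * (s * v) ^ k := by
            rw [pow_succ, pow_succ']; simp only [mul_assoc]
        _ = a := by rw [h, ih]
  have h2 : u ^ n * a = a := by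
    calc u ^ n * a = u ^ n * (u ^ n * a * (s * v) ^ n) := by rw [h1]
      _ = a := by rw [← mul_assoc, ← mul_assoc, hid, h1]
  obtain ⟨k, rfl⟩ : ∃ k, n = k + 1 := ⟨n - 1, by omega⟩
  refine ⟨v * (s * v) ^ k, ?_⟩
  calc a * s * (v * (s * v) ^ k) = a * (s * v) ^ (k + 1) := by
        rw [pow_succ']; simp only [mul_assoc]
    _ = a := by
        conv_lhs => rw [← h2]
        exact h1 _

namespace IsJClass

variable {K : Set M} (hK : IsJClass K)

include hK

theorem op : IsJClass (MulOpposite.unop ⁻¹' K) := by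
  intro a ha b
  rw [Set.mem_preimage, hK _ ha]
  constructor
  · rintro ⟨⟨u, v, h⟩, ⟨u', v', h'⟩⟩
    exact ⟨⟨.op v, .op u, MulOpposite.unop_injective (by simpa [mul_assoc] using h)⟩,
      ⟨.op v', .op u', MulOpposite.unop_injective (by simpa [mul_assoc] using h')⟩⟩
  · rintro ⟨⟨u, v, h⟩, ⟨u', v', h'⟩⟩
    exact ⟨⟨v.unop, u.unop, by rw [← h]; simp [mul_assoc]⟩,
      ⟨v'.unop, u'.unop, by rw [← h']; simp [mul_assoc]⟩⟩

theorem mem_of_le_of_le {a b u v u' v' : M} (ha : a ∈ K) (hb : u * a * v = b)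
    (hc : u' * b * v' ∈ K) : b ∈ K := by
  obtain ⟨x, y, h⟩ := ((hK a ha _).1 hc).2
  exact (hK a ha b).2 ⟨⟨u, v, hb⟩, ⟨x * u', v' * y, by rw [← h]; simp only [mul_assoc]⟩⟩

theorem mul_mem_of_mul_mem_right {a b t : M} (ha : a ∈ K) (h : a * b * t ∈ K) : a * b ∈ K :=
  hK.mem_of_le_of_le (u := 1) (v := b) (u' := 1) (v' := t) ha (by simp) (by simpa using h)

theorem mul_mem_of_mul_mem_left {a b t : M} (ha : a ∈ K) (h : t * (b * a) ∈ K) : b * a ∈ K :=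
  hK.mem_of_le_of_le (u := b) (v := 1) (u' := t) (v' := 1) ha (by simp) (by simpa using h)

theorem mul_mem_of_rel {x y s t : M} (hx : x ∈ K) (h : t * x * (y * s) ∈ K) : x * y ∈ K :=
  hK.mem_of_le_of_le (u := 1) (v := y) (u' := t) (v' := s) hx (by simp)
    (by simpa only [mul_assoc] using h)

theorem mem_of_rRel {a b : M} (ha : a ∈ K) (h : RRel a b) : b ∈ K := by
  obtain ⟨⟨s, rfl⟩, t, ht⟩ := h
  exact hK.mul_mem_of_mul_mem_right (t := t) ha (by rwa [ht])

variable [Finite M]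

theorem rRel_mul {a s : M} (ha : a ∈ K) (h : a * s ∈ K) : RRel a (a * s) := by
  obtain ⟨u, v, huv⟩ := ((hK a ha _).1 h).2
  exact ⟨⟨s, rfl⟩, exists_mul_eq_of_mul_mul_eq huv⟩

theorem lRel_mul {a s : M} (ha : a ∈ K) (h : s * a ∈ K) : LRel a (s * a) := by
  have := finite_mulOpposite M
  rw [← rRel_op_iff, MulOpposite.op_mul]
  exact hK.op.rRel_mul (a := .op a) ha (by simpa using h)

/-- Stability gives t with t * (x * a) = a, so x * a * y lies 𝒥-between x and a * y. -/
theorem mul_mul_mem {x a y : M} (hx : x ∈ K) (ha : a ∈ K) (hxa : x * a ∈ K) (hay : a * y ∈ K) :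
    x * a * y ∈ K := by
  obtain ⟨t, ht⟩ := (hK.lRel_mul ha hxa).2
  exact hK.mem_of_le_of_le (u := 1) (v := a * y) (u' := t) (v' := 1) hx
    (by simp [mul_assoc]) (by rw [mul_one, ← mul_assoc, ht]; exact hay)

/-- This is 𝒥 = 𝒟 in the finite case: if z = u * a * v, the element a * v lies in the ℛ-class of a
and the ℒ-class of z. -/
theorem exists_rRel_lRel {a z : M} (ha : a ∈ K) (hz : z ∈ K) :
    ∃ x ∈ K, RRel a x ∧ LRel z x := by
  obtain ⟨u, v, rfl⟩ := ((hK a ha z).1 hz).1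
  have h : a * v ∈ K := hK.mul_mem_of_rel (t := u) (s := 1) ha (by simpa using hz)
  refine ⟨a * v, h, hK.rRel_mul ha h, ?_⟩
  rw [mul_assoc] at hz ⊢
  exact (hK.lRel_mul h hz).symm

theorem exists_mul_mem_right {a z : M} (ha : a ∈ K) (haa : a * a ∈ K) (hz : z ∈ K) :
    ∃ s ∈ K, z * s ∈ K ∧ LRel a s := by
  obtain ⟨x, hx, ⟨-, t, ht⟩, ⟨t', ht'⟩, -⟩ := hK.exists_rRel_lRel ha hz
  have h1 : x * (t * a) = a * a := by rw [← mul_assoc, ht]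
  have h2 : t * a ∈ K := hK.mul_mem_of_mul_mem_left (t := x) ha (by rwa [h1])
  exact ⟨t * a, h2, hK.mul_mem_of_rel (t := t') (s := 1) hz (by rwa [ht', mul_one, h1]),
    hK.lRel_mul ha h2⟩

theorem exists_mul_mem_left {a z : M} (ha : a ∈ K) (haa : a * a ∈ K) (hz : z ∈ K) :
    ∃ s ∈ K, s * z ∈ K := by
  obtain ⟨x, hx, ⟨⟨v, hv⟩, -⟩, -, t, ht⟩ := hK.exists_rRel_lRel hz ha
  have h1 : a * t * x = a * a := by rw [mul_assoc, ht]
  have h2 : a * t ∈ K := hK.mul_mem_of_mul_mem_right (t := x) ha (by rwa [h1])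
  exact ⟨a * t, h2, hK.mul_mem_of_rel (t := 1) (s := v) h2 (by rwa [hv, one_mul, h1])⟩

end IsJClass

/-! ### Products in a `𝒥`-class with a persistent set -/

/-- Every pair of a persistent set of pairs in `K` has both its products in `K`. -/
def ProductsStay (K : Set M) : Prop :=
  ∀ Q : Set (M × M), Persistent Set.univ Q → (∀ p ∈ Q, p.1 ∈ K ∧ p.2 ∈ K) →
    ∀ p ∈ Q, p.1 * p.2 ∈ K ∧ p.2 * p.1 ∈ K

/-- No persistent set of pairs in `N` contains a commuting pair. -/
def NoCommutingPairs (N : Set M) : Prop :=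
  ∀ Q : Set (M × M), Persistent Set.univ Q → (∀ p ∈ Q, p.1 ∈ N ∧ p.2 ∈ N) →
    ∀ p ∈ Q, p.1 * p.2 ≠ p.2 * p.1

-- Reversing products interchanges the two components of a successor, so both orders of each pair
-- have to be included.
open MulOpposite in
theorem Persistent.unop {Q : Set (Mᵐᵒᵖ × Mᵐᵒᵖ)} (hQ : Persistent Set.univ Q) :
    Persistent Set.univ {p : M × M | (op p.1, op p.2) ∈ Q ∨ (op p.2, op p.1) ∈ Q} := by
  rintro p (hp | hp)
  · obtain ⟨h1, w, -, h2⟩ := hQ _ hp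
    exact ⟨fun h => h1 (congrArg op h), w.unop, trivial, Or.inr (by simpa [mul_assoc] using h2)⟩
  · obtain ⟨h1, w, -, h2⟩ := hQ _ hp
    exact ⟨fun h => h1 (congrArg op h).symm, w.unop, trivial,
      Or.inl (by simpa [mul_assoc] using h2)⟩

theorem ProductsStay.op {K : Set M} (h : ProductsStay K) :
    ProductsStay (MulOpposite.unop ⁻¹' K) := by
  intro Q hQ hQK p hp
  exact (h _ hQ.unop (by rintro q (hq | hq); exacts [hQK _ hq, (hQK _ hq).symm])
    (p.1.unop, p.2.unop) (Or.inl hp)).symm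

theorem NoCommutingPairs.op {N : Set M} (h : NoCommutingPairs N) :
    NoCommutingPairs (MulOpposite.unop ⁻¹' N) := by
  intro Q hQ hQN p hp hc
  exact h _ hQ.unop (by rintro q (hq | hq); exacts [hQN _ hq, (hQN _ hq).symm])
    (p.1.unop, p.2.unop) (Or.inl hp) (congrArg MulOpposite.unop hc).symm

namespace IsJClass

variable [Finite M] {K : Set M} (hK : IsJClass K)

include hK

/-- With s fixed as the connector, all such pairs form one persistent set: x * s * y stays in the
ℛ-class of x, so the successors are again not ℛ-related. -/
theorem mul_mem_of_not_rRel (hE : ProductsStay K) {x y s : M} (hx : x ∈ K) (hy : y ∈ K)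
    (hs : s ∈ K) (hxy : ¬ RRel x y) (hxs : x * s ∈ K) (hys : y * s ∈ K) (hsx : s * x ∈ K)
    (hsy : s * y ∈ K) : x * y ∈ K ∧ y * x ∈ K := by
  have key : ∀ x y, x ∈ K → y ∈ K → x * s ∈ K → y * s ∈ K → s * x ∈ K → s * y ∈ K →
      x * s * y ∈ K ∧ x * s * y * s ∈ K ∧ s * (x * s * y) ∈ K := by
    intro x y hx hy hxs hys hsx hsy
    refine ⟨hK.mul_mul_mem hx hs hxs hsy, ?_, ?_⟩
    · rw [mul_assoc (x * s)]
      exact hK.mul_mul_mem hx hs hxs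
        (by rw [← mul_assoc]; exact hK.mul_mul_mem hs hy hsy hys)
    · rw [← mul_assoc, ← mul_assoc]
      exact hK.mul_mul_mem hsx hs (hK.mul_mul_mem hs hx hsx hxs) hsy
  refine hE {p | p.1 ∈ K ∧ p.2 ∈ K ∧ ¬ RRel p.1 p.2 ∧ p.1 * s ∈ K ∧ p.2 * s ∈ K ∧ s * p.1 ∈ K ∧
    s * p.2 ∈ K} ?_ (fun p hp => ⟨hp.1, hp.2.1⟩) (x, y) ⟨hx, hy, hxy, hxs, hys, hsx, hsy⟩
  rintro ⟨x, y⟩ ⟨hx, hy, hxy, hxs, hys, hsx, hsy⟩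
  obtain ⟨h1, h2, h3⟩ := key x y hx hy hxs hys hsx hsy
  obtain ⟨h4, h5, h6⟩ := key y x hy hx hys hxs hsy hsx
  refine ⟨fun h => hxy (h ▸ RRel.refl _), s, trivial, h1, h4, fun h => hxy ?_, h2, h5, h3, h6⟩
  rw [mul_assoc] at h1 h4
  simp only [mul_assoc] at h
  exact (hK.rRel_mul hx h1).trans (h.trans (hK.rRel_mul hy h4).symm)

/-- One pair that is not ℛ-related propagates: z is replaced by members of its ℒ-class in chosen
ℛ-classes, to which `mul_mem_of_not_rRel` applies. -/
theorem mul_mem_of_exists_not_rRel (hE : ProductsStay K) {a b : M} (ha : a ∈ K) (hb : b ∈ K)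
    (haa : a * a ∈ K) (hab : a * b ∈ K) (h : ¬ RRel a b) {z z' : M}
    (hz : z ∈ K) (hz' : z' ∈ K) : z * z' ∈ K := by
  -- Whether a product falls in K depends only on the ℒ-class of its left factor and the ℛ-class of
  -- its right factor.
  have rel : ∀ {x x' y y' : M}, x' ∈ K → LRel x x' → RRel y y' → x * y ∈ K → x' * y' ∈ K := by
    rintro x x' y y' hx' ⟨-, t, rfl⟩ ⟨-, s, rfl⟩ hxy
    exact hK.mul_mem_of_rel hx' hxy
  -- multiplication by `a` on the right stays in `K`
  have step : ∀ z ∈ K, z * a ∈ K := by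
    intro z hz
    obtain ⟨s, hs, hzs, has⟩ := hK.exists_mul_mem_right ha haa hz
    obtain ⟨x, hx, hax, hzx⟩ := hK.exists_rRel_lRel ha hz
    obtain ⟨y, hy, hby, hzy⟩ := hK.exists_rRel_lRel hb hz
    have := hK.mul_mem_of_not_rRel hE hx hy hs
      (fun hxy => h (hax.trans (hxy.trans hby.symm)))
      (rel hx hzx (.refl s) hzs) (rel hy hzy (.refl s) hzs)
      (rel hs has hax haa) (rel hs has hby hab)
    exact rel hz hzy.symm hax.symm this.2
  by_cases hz'a : RRel z' a
  · exact rel hz (.refl z) hz'a.symm (step z hz)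
  -- By `step`, right factors in the ℛ-class of a are harmless. So both the substitute x for z and
  -- the connector w are taken in that class, and only w * z' needs s.
  obtain ⟨s, hs, hsz'⟩ := hK.exists_mul_mem_left ha haa hz'
  obtain ⟨x, hx, hax, hzx⟩ := hK.exists_rRel_lRel ha hz
  obtain ⟨w, hw, haw, hsw⟩ := hK.exists_rRel_lRel ha hs
  have hstep : ∀ z ∈ K, ∀ y, RRel a y → z * y ∈ K :=
    fun z hz y hy => rel hz (.refl z) hy (step z hz)
  have := hK.mul_mem_of_not_rRel hE hx hz' hw (fun hxz => hz'a (hax.trans hxz).symm)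
    (hstep x hx w haw) (hstep z' hz' w haw) (hstep w hw x hax) (rel hw hsw (.refl z') hsz')
  exact rel hz hzx.symm (.refl z') this.1

end IsJClass

/-- A persistent set of pairs does not lie inside a regular `ℋ`-class: translating it by an inverse
of `a` gives a persistent set with a commuting pair. -/
theorem NoCommutingPairs.not_mem_of_hClass {N : Set M} (hN : NoCommutingPairs N) {W : Set M}
    {Q : Set (M × M)} (hQ : Persistent W Q) {a g : M} (hg : a * g * a = a)
    (hQa : ∀ p ∈ Q, (RRel a p.1 ∧ LRel a p.1) ∧ RRel a p.2 ∧ LRel a p.2)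
    (hQN : ∀ p ∈ Q, p.1 * g ∈ N ∧ p.2 * g ∈ N) (b : M) : (a, b) ∉ Q := by
  intro hab
  have key : ∀ q, LRel a q → q * g * a = q := by
    rintro q ⟨⟨t, rfl⟩, -⟩
    rw [mul_assoc t, mul_assoc t, hg]
  refine hN ((fun p : M × M => (p.1 * g, p.2 * g)) '' Q) ?_ ?_ (a * g, b * g) ⟨_, hab, rfl⟩ ?_
  · rintro _ ⟨⟨p, q⟩, hp, rfl⟩
    obtain ⟨h1, w, -, h2⟩ := hQ _ hp
    obtain ⟨⟨-, hpL⟩, -, hqL⟩ := hQa _ hp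
    -- As q * g * a = q for q in the ℒ-class of a, the connector a * w does for the translated pair
    -- what w did for the original one.
    refine ⟨fun h => h1 ?_, a * w, trivial, _, h2, ?_⟩
    · rw [← key _ hpL, ← key _ hqL]
      exact congrArg (· * a) h
    · simp only [← mul_assoc, key _ hpL, key _ hqL]
  · rintro _ ⟨p, hp, rfl⟩
    exact hQN p hp
  · obtain ⟨-, ⟨⟨s, rfl⟩, -⟩, hbL⟩ := hQa _ hab
    change a * g * (a * s * g) = a * s * g * (a * g)
    rw [← mul_assoc _ a g, key _ hbL]
    simp only [← mul_assoc, hg]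

namespace IsJClass

variable [Finite M] {K : Set M} (hK : IsJClass K)

include hK

theorem exists_regular {a : M} (ha : a ∈ K) (haa : a * a ∈ K) : ∃ g, a * g * a = a := by
  obtain ⟨t, ht⟩ := (hK.rRel_mul ha haa).2
  obtain ⟨s, hs⟩ := (hK.lRel_mul ha haa).2
  refine ⟨s, ?_⟩
  calc a * s * a = a * s * (a * a * t) := by rw [ht]
    _ = a * (s * (a * a)) * t := by simp only [mul_assoc]
    _ = a := by rw [hs, ht]

/-- A `𝒥`-class that contains a persistent set of pairs is closed under products, and it is not a
single `ℋ`-class. -/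
theorem mul_mem_of_persistent (hE : ProductsStay K) {N : Set M} (hC : NoCommutingPairs N)
    (hKN : ∀ a ∈ K, ∀ b, a * b ∈ N) {Q : Set (M × M)} (hQ : Persistent Set.univ Q)
    (hQK : ∀ p ∈ Q, p.1 ∈ K ∧ p.2 ∈ K) (hne : Q.Nonempty) :
    (∀ z ∈ K, ∀ z' ∈ K, z * z' ∈ K) ∧ ∃ a ∈ K, ∃ b ∈ K, ¬ RRel a b ∨ ¬ LRel a b := by
  -- The square of p.1 occurs inside the product (p.2 * w * p.1) * (p.1 * w * p.2) of the components
  -- of the successor.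
  have sq : ∀ p ∈ Q, p.1 * p.1 ∈ K ∧ p.1 * p.2 ∈ K ∧ p.2 * p.1 ∈ K := by
    intro p hp
    obtain ⟨h1, h2⟩ := hE Q hQ hQK p hp
    obtain ⟨w, -, h⟩ := (hQ p hp).2
    refine ⟨?_, h1, h2⟩
    have h3 := (hE Q hQ hQK _ h).2
    refine hK.mul_mem_of_rel (t := p.2 * w) (s := w * p.2) (hQK p hp).1 ?_
    simpa only [mul_assoc] using h3
  by_cases hR : ∃ p ∈ Q, ¬ RRel p.1 p.2
  · obtain ⟨p, hp, hn⟩ := hR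
    obtain ⟨h1, h2, h3⟩ := sq p hp
    exact ⟨fun z hz z' hz' => hK.mul_mem_of_exists_not_rRel hE (hQK p hp).1 (hQK p hp).2 h1 h2 hn
      hz hz', _, (hQK p hp).1, _, (hQK p hp).2, Or.inl hn⟩
  by_cases hL : ∃ p ∈ Q, ¬ LRel p.1 p.2
  · have := finite_mulOpposite M
    obtain ⟨p, hp, hn⟩ := hL
    obtain ⟨h1, h2, h3⟩ := sq p hp
    refine ⟨fun z hz z' hz' => ?_, _, (hQK p hp).1, _, (hQK p hp).2, Or.inr hn⟩
    exact hK.op.mul_mem_of_exists_not_rRel hE.op (a := .op p.1) (b := .op p.2) (z := .op z')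
      (z' := .op z) (hQK p hp).1 (hQK p hp).2 h1 h3 (fun h => hn (rRel_op_iff.1 h)) hz' hz
  -- Now the components of each pair are ℋ-related, and the pairs in the ℋ-class of a form a
  -- persistent set by themselves.
  push Not at hR hL
  exfalso
  obtain ⟨⟨a, b⟩, hab⟩ := hne
  obtain ⟨g, hg⟩ := hK.exists_regular (hQK _ hab).1 (sq _ hab).1
  refine hC.not_mem_of_hClass (W := Set.univ)
    (Q := {p ∈ Q | (RRel a p.1 ∧ LRel a p.1) ∧ RRel a p.2 ∧ LRel a p.2}) ?_ hg
    (fun p hp => hp.2) (fun p hp => ⟨hKN _ (hQK p hp.1).1 _, hKN _ (hQK p hp.1).2 _⟩) b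
    ⟨hab, ⟨.refl _, .refl _⟩, hR _ hab, hL _ hab⟩
  rintro p ⟨hp, ⟨h1, h2⟩, h3, h4⟩
  obtain ⟨hne, w, -, hw⟩ := hQ p hp
  refine ⟨hne, w, trivial, hw, ?_⟩
  obtain ⟨h5, h6⟩ := hQK _ hw
  have h7 := hK.lRel_mul (hQK p hp).2 h5
  have h8 := hK.lRel_mul (hQK p hp).1 h6
  simp only [mul_assoc] at h5 h6
  have h9 := hK.rRel_mul (hQK p hp).1 h5
  have h10 := hK.rRel_mul (hQK p hp).2 h6
  simp only [← mul_assoc] at h9 h10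
  exact ⟨⟨h1.trans h9, h4.trans h7⟩, h3.trans h10, h2.trans h8⟩

end IsJClass

/-! ### The action of the elements above a closed `𝒥`-class -/

/-- `a` lies above some element of `K` in the `𝒥`-order. -/
def IsAbove (K : Set M) (a : M) : Prop := ∃ u v, u * a * v ∈ K

theorem IsAbove.of_mem {K : Set M} {a : M} (ha : a ∈ K) : IsAbove K a := ⟨1, 1, by simpa using ha⟩

theorem IsAbove.of_mul_mul {K : Set M} {a u v : M} (h : IsAbove K (u * a * v)) : IsAbove K a := by
  obtain ⟨x, y, h⟩ := h
  exact ⟨x * u, v * y, by simpa only [mul_assoc] using h⟩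

theorem IsAbove.op {K : Set M} {a : M} (h : IsAbove K a) :
    IsAbove (MulOpposite.unop ⁻¹' K) (MulOpposite.op a) := by
  obtain ⟨x, y, h⟩ := h
  exact ⟨.op y, .op x, by simpa [mul_assoc] using h⟩

/-- A nonempty `𝒥`-class that is closed under products. -/
structure IsClosedJClass (K : Set M) : Prop where
  isJClass : IsJClass K
  mul_mem : ∀ a ∈ K, ∀ b ∈ K, a * b ∈ K
  nonempty : K.Nonempty

namespace IsClosedJClass

variable {K : Set M} (hK : IsClosedJClass K)

include hK

theorem op : IsClosedJClass (MulOpposite.unop ⁻¹' K) where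
  isJClass := hK.isJClass.op
  mul_mem _ ha _ hb := hK.mul_mem _ hb _ ha
  nonempty := let ⟨k, hk⟩ := hK.nonempty; ⟨.op k, hk⟩

/-- Squaring u * a * v inside K gives u * a * v * u * a ∈ K; its product with k is in K and is a
left multiple of a * k. -/
theorem above_mul_mem {a k : M} (ha : IsAbove K a) (hk : k ∈ K) : a * k ∈ K := by
  obtain ⟨u, v, h⟩ := ha
  have h1 : u * a * v * u * a ∈ K := by
    refine hK.isJClass.mul_mem_of_mul_mem_right (a := u * a * v) (b := u * a) (t := v) h ?_
      |> fun h' => by simpa only [mul_assoc] using h'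
    simpa only [mul_assoc] using hK.mul_mem _ h _ h
  have h2 := hK.mul_mem _ h1 _ hk
  exact hK.isJClass.mul_mem_of_mul_mem_left (t := u * a * v * u) hk
    (by simpa only [mul_assoc] using h2)

theorem mul_above_mem {a k : M} (ha : IsAbove K a) (hk : k ∈ K) : k * a ∈ K :=
  hK.op.above_mul_mem (a := .op a) (k := .op k) ha.op hk

theorem above_mul {a b : M} (ha : IsAbove K a) (hb : IsAbove K b) : IsAbove K (a * b) := by
  obtain ⟨k, hk⟩ := hK.nonempty
  exact ⟨1, k, by simpa [mul_assoc] using hK.above_mul_mem ha (hK.above_mul_mem hb hk)⟩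

variable [Finite M]

theorem rRel_mul {a b : M} (ha : a ∈ K) (hb : IsAbove K b) : RRel a (a * b) :=
  hK.isJClass.rRel_mul ha (hK.mul_above_mem hb ha)

theorem lRel_mul {a b : M} (ha : a ∈ K) (hb : IsAbove K b) : LRel a (b * a) :=
  hK.isJClass.lRel_mul ha (hK.above_mul_mem hb ha)

/-- The pairs of elements above `K` that act differently on the `ℛ`-classes of `K` form a persistent
set. -/
theorem persistent_of_not_rRel {u : M} (hu : u ∈ K) :
    Persistent Set.univ {p : M × M | IsAbove K p.1 ∧ IsAbove K p.2 ∧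
      ∃ w ∈ K, ¬ RRel (p.1 * w) (p.2 * w)} := by
  rintro ⟨a, b⟩ ⟨ha, hb, w, hw, hab⟩
  simp only at ha hb hab
  have h1 := hK.above_mul_mem ha hw
  have h2 := hK.above_mul_mem hb hw
  have h3 := hK.mul_above_mem hb h1
  have h4 := hK.mul_above_mem ha h2
  -- Inside K, right multiplication preserves ℛ-classes, so a * w * b and b * w * a send u to the
  -- classes of a * w and b * w, which differ.
  refine ⟨fun h => hab (by obtain rfl : a = b := h; exact .refl _), w, trivial, .of_mem h3,
    .of_mem h4, u, hu, fun h => hab ?_⟩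
  exact (hK.rRel_mul h1 hb).trans ((hK.rRel_mul h3 (.of_mem hu)).trans
    (h.trans ((hK.rRel_mul h2 ha).trans (hK.rRel_mul h4 (.of_mem hu))).symm))

variable {N : Set M} (hC : NoCommutingPairs N) (hN : ∀ a ∈ N, ∀ b, a * b ∈ N ∧ b * a ∈ N)

include hC hN

/-- Otherwise (a, b) would be a commuting pair in the persistent set of `persistent_of_not_rRel`,
cut down to N. -/
theorem rRel_mul_of_commute {a b u : M} (ha : IsAbove K a) (hb : IsAbove K b) (haN : a ∈ N)
    (hbN : b ∈ N) (hab : a * b = b * a) (hu : u ∈ K) : RRel (a * u) (b * u) := by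
  by_contra h
  refine hC ({p : M × M | IsAbove K p.1 ∧ IsAbove K p.2 ∧
    ∃ w ∈ K, ¬ RRel (p.1 * w) (p.2 * w)} ∩ {p | p.1 ∈ N ∧ p.2 ∈ N}) ?_ (fun p hp => hp.2) (a, b)
    ⟨⟨ha, hb, u, hu, h⟩, haN, hbN⟩ hab
  rintro p ⟨hp, hpN⟩
  obtain ⟨h1, w, hw, h2⟩ := hK.persistent_of_not_rRel hu p hp
  exact ⟨h1, w, hw, h2, (hN _ (hN _ hpN.1 _).1 _).1, (hN _ (hN _ hpN.2 _).1 _).1⟩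

variable (hKN : K ⊆ N)

include hKN

/-- The element a commutes with its idempotent power ε, and ε commutes with ε * u * ε ∈ K. All three
thus act alike on ℛ-classes, and elements of K act as constants. -/
theorem rRel_mul_mul {a u v : M} (ha : IsAbove K a) (haN : a ∈ N) (hu : u ∈ K) (hv : v ∈ K) :
    RRel (a * u) (a * v) := by
  obtain ⟨n, hn, hid⟩ := exists_pow_idempotent a
  have hpow : ∀ n, 0 < n → IsAbove K (a ^ n) ∧ a ^ n ∈ N := by
    intro n hn
    induction n, hn using Nat.le_induction with
    | base => simpa using ⟨ha, haN⟩
    | succ n _ ih => rw [pow_succ]; exact ⟨hK.above_mul ih.1 ha, (hN _ haN _).2⟩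
  obtain ⟨hε, hεN⟩ := hpow n hn
  set ε := a ^ n
  have hx : ε * u * ε ∈ K := hK.mul_above_mem hε (hK.above_mul_mem hε hu)
  have key : ∀ w ∈ K, RRel (a * w) (ε * u * ε) := fun w hw =>
    ((hK.rRel_mul_of_commute hC hN ha hε haN hεN
      ((Commute.refl a).pow_right n).eq hw).trans
    (hK.rRel_mul_of_commute hC hN hε (.of_mem hx) hεN (hKN hx)
      (by simp only [mul_assoc, hid]; simp only [← mul_assoc, hid]) hw)).trans
    (hK.rRel_mul hx (.of_mem hw)).symm
  exact (key u hu).trans (key v hv).symm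

theorem lRel_mul_mul {a u v : M} (ha : IsAbove K a) (haN : a ∈ N) (hu : u ∈ K) (hv : v ∈ K) :
    LRel (u * a) (v * a) :=
  have := finite_mulOpposite M
  rRel_op_iff.1 (hK.op.rRel_mul_mul hC.op (fun _ ha _ => (hN _ ha _).symm) (fun _ h => hKN h)
    (a := .op a) (u := .op u) (v := .op v) ha.op haN hu hv)

end IsClosedJClass

end Green

/-! ### Consequences of pseudo-nilpotency -/

section

variable {S : Type u} [Semigroup S]

theorem finite_withOne (S : Type*) [Finite S] : Finite (WithOne S) :=
  inferInstanceAs (Finite (Option S))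

theorem exists_coe_eq_mul_coe_mul (u v : WithOne S) (a : S) : ∃ s : S, u * (a : WithOne S) * v = s := by
  cases u <;> cases v
  exacts [⟨a, by simp⟩, ⟨_, by rw [one_mul, ← WithOne.coe_mul]⟩,
    ⟨_, by rw [mul_one, ← WithOne.coe_mul]⟩, ⟨_, by rw [← WithOne.coe_mul, ← WithOne.coe_mul]⟩]

theorem SgIdeal.mem_of_mul_mul_eq (J : SgIdeal S) {u v : WithOne S} {a s : S} (ha : a ∈ J.carrier)
    (h : u * (a : WithOne S) * v = s) : s ∈ J.carrier := by
  cases u <;> cases v <;> simp only [one_mul, mul_one, ← WithOne.coe_mul, WithOne.coe_inj] at h <;>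
    subst h
  exacts [ha, J.mul_mem_right _ ha, J.mul_mem_left _ ha, J.mul_mem_right _ (J.mul_mem_left _ ha)]

theorem mul_mul_comm_of_mem_closure {A : Set S} (hA : ∀ a ∈ A, ∀ b ∈ A, a * b = b * a)
    {x y w : WithOne S}
    (hx : x ∈ insert 1 ((↑) '' (Subsemigroup.closure A : Set S) : Set (WithOne S)))
    (hy : y ∈ insert 1 ((↑) '' (Subsemigroup.closure A : Set S) : Set (WithOne S)))
    (hw : w ∈ insert 1 ((↑) '' (Subsemigroup.closure A : Set S) : Set (WithOne S))) :
    x * w * y = y * w * x := by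
  have key : ∀ x y : WithOne S,
      x ∈ insert 1 ((↑) '' (Subsemigroup.closure A : Set S) : Set (WithOne S)) →
      y ∈ insert 1 ((↑) '' (Subsemigroup.closure A : Set S) : Set (WithOne S)) →
      x * y = y * x := by
    have := Subsemigroup.isMulCommutative_closure S hA
    rintro _ _ (rfl | ⟨x, hx, rfl⟩) (rfl | ⟨y, hy, rfl⟩)
    · rfl
    · simp
    · simp
    · have := mul_comm' (⟨x, hx⟩ : Subsemigroup.closure A) ⟨y, hy⟩
      rw [← WithOne.coe_mul, ← WithOne.coe_mul]
      exact congrArg _ (congrArg Subtype.val this)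
  rw [mul_assoc, key w y hw hy, ← mul_assoc, key x y hx hy, mul_assoc, key x w hx hw, mul_assoc]

theorem not_adj_of_commute [Finite S] {x y : S} (h : x * y = y * x) :
    ¬ (upperNonNilpotentGraph S).Adj x y := by
  intro hadj
  obtain ⟨Q, ⟨p, hp⟩, hQ, hQC⟩ :=
    exists_persistent_of_adj (SgIdeal.empty S) ((SgIdeal.adj_mk_empty_iff x y).2 hadj)
  obtain ⟨-, w, hw, hw'⟩ := hQ p hp
  refine (hQ _ hw').1 (mul_mul_comm_of_mem_closure ?_ (Or.inr ?_) (Or.inr ?_) hw)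
  · rintro a (rfl | rfl) b (rfl | rfl)
    exacts [rfl, h, h.symm, rfl]
  · exact Set.image_mono Set.sdiff_subset (hQC p hp).1
  · exact Set.image_mono Set.sdiff_subset (hQC p hp).2

/-- Persistent pairs are edges and commuting pairs are not. The adjoined identity is excluded
because edges join elements of S. -/
theorem PseudoNilpotent.noCommutingPairs [Finite S] (h : PseudoNilpotent S) :
    NoCommutingPairs ({1}ᶜ : Set (WithOne S)) := by
  rintro Q hQ hN ⟨x, y⟩ hp hc
  obtain ⟨x, rfl⟩ := WithOne.ne_one_iff_exists.1 (hN _ hp).1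
  obtain ⟨y, rfl⟩ := WithOne.ne_one_iff_exists.1 (hN _ hp).2
  exact not_adj_of_commute (WithOne.coe_injective hc) (h.adj hQ hp)

theorem mul_mem_compl_one {a : WithOne S} (ha : a ∈ ({1}ᶜ : Set (WithOne S))) (b : WithOne S) :
    a * b ∈ ({1}ᶜ : Set (WithOne S)) ∧ b * a ∈ ({1}ᶜ : Set (WithOne S)) := by
  obtain ⟨a, rfl⟩ := WithOne.ne_one_iff_exists.1 ha
  obtain ⟨s, hs⟩ := exists_coe_eq_mul_coe_mul 1 b a
  obtain ⟨t, ht⟩ := exists_coe_eq_mul_coe_mul b 1 a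
  rw [one_mul] at hs
  rw [mul_one] at ht
  rw [hs, ht]
  exact ⟨WithOne.coe_ne_one, WithOne.coe_ne_one⟩

/-- Two elements that are adjacent modulo an ideal `J` have their product outside `J`. -/
theorem mul_notMem_of_adj [Finite S] (J : SgIdeal S) {a b : S}
    (h : (upperNonNilpotentGraph J.ReesFactor).Adj (J.toFactor a) (J.toFactor b)) :
    a * b ∉ J.carrier := by
  intro hab
  obtain ⟨Q, ⟨⟨u, v⟩, hp⟩, hQ, hQC⟩ := exists_persistent_of_adj J h
  let C := Subsemigroup.closure ({a, b} : Set S)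
  -- As a * b ∈ J, a word outside J never has a directly before b. So it is a power of a or starts
  -- with b, and it is a power of b or ends with a.
  let startsB : WithOne S → Prop := fun z => ∃ t, z = (b : WithOne S) * t
  let endsA : WithOne S → Prop := fun z => ∃ t, z = t * (a : WithOne S)
  have hJ : ∀ (y z : WithOne S) (s : S), endsA y → startsB z → y * z = s → s ∈ J.carrier := by
    rintro _ _ s ⟨t, rfl⟩ ⟨t', rfl⟩ hs
    exact J.mem_of_mul_mul_eq (u := t) (v := t') hab
      (by rw [← hs, WithOne.coe_mul]; simp only [mul_assoc])
  let A : Set (WithOne S) := insert 1 ((↑) '' (Subsemigroup.closure {a} : Set S))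
  let B : Set (WithOne S) := insert 1 ((↑) '' (Subsemigroup.closure {b} : Set S))
  have hAend : ∀ z ∈ Subsemigroup.closure {a}, endsA (z : WithOne S) := by
    intro z hz
    induction hz using Subsemigroup.closure_induction with
    | mem x hx => obtain rfl : x = a := hx; exact ⟨1, (one_mul _).symm⟩
    | mul x y _ _ _ ih => obtain ⟨t, ht⟩ := ih; exact ⟨x * t, by rw [WithOne.coe_mul, ht, mul_assoc]⟩
  have hBstart : ∀ z ∈ Subsemigroup.closure {b}, startsB (z : WithOne S) := by
    intro z hz
    induction hz using Subsemigroup.closure_induction with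
    | mem x hx => obtain rfl : x = b := hx; exact ⟨1, (mul_one _).symm⟩
    | mul x y _ _ ih _ => obtain ⟨t, ht⟩ := ih; exact ⟨t * y, by rw [WithOne.coe_mul, ht, mul_assoc]⟩
  have hstart : ∀ z ∈ C, z ∈ J.carrier ∨ z ∈ Subsemigroup.closure {a} ∨ startsB (z : WithOne S) := by
    intro z hz
    induction hz using Subsemigroup.closure_induction with
    | mem x hx =>
      rcases hx with rfl | rfl
      · exact Or.inr (Or.inl (Subsemigroup.subset_closure rfl))
      · exact Or.inr (Or.inr ⟨1, (mul_one _).symm⟩)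
    | mul x y _ _ ihx ihy =>
      rcases ihx with hx | hx | ⟨t, ht⟩
      · exact Or.inl (J.mul_mem_right _ hx)
      · rcases ihy with hy | hy | hy
        · exact Or.inl (J.mul_mem_left _ hy)
        · exact Or.inr (Or.inl (mul_mem hx hy))
        · exact Or.inl (hJ _ _ _ (hAend x hx) hy (WithOne.coe_mul _ _).symm)
      · exact Or.inr (Or.inr ⟨t * y, by rw [WithOne.coe_mul, ht, mul_assoc]⟩)
  have hend : ∀ z ∈ C, z ∈ J.carrier ∨ z ∈ Subsemigroup.closure {b} ∨ endsA (z : WithOne S) := by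
    intro z hz
    induction hz using Subsemigroup.closure_induction with
    | mem x hx =>
      rcases hx with rfl | rfl
      · exact Or.inr (Or.inr ⟨1, (one_mul _).symm⟩)
      · exact Or.inr (Or.inl (Subsemigroup.subset_closure rfl))
    | mul x y _ _ ihx ihy =>
      rcases ihy with hy | hy | ⟨t, ht⟩
      · exact Or.inl (J.mul_mem_left _ hy)
      · rcases ihx with hx | hx | hx
        · exact Or.inl (J.mul_mem_right _ hx)
        · exact Or.inr (Or.inl (mul_mem hx hy))
        · exact Or.inl (hJ _ _ _ hx (hBstart y hy) (WithOne.coe_mul _ _).symm)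
      · exact Or.inr (Or.inr ⟨x * t, by rw [WithOne.coe_mul, ht, mul_assoc]⟩)
  obtain ⟨-, w, hw, hnext⟩ := hQ _ hp
  obtain ⟨⟨u, ⟨huC, huJ⟩, rfl⟩, v, ⟨hvC, hvJ⟩, rfl⟩ := hQC _ hp
  obtain ⟨⟨c, ⟨-, hcJ⟩, hc⟩, d, ⟨-, hdJ⟩, hd⟩ := hQC _ hnext
  simp only at hc hd hnext
  have hne := (hQ _ hnext).1
  have hcomm : ∀ s : S, ¬ ((u : WithOne S) ∈ insert 1 ((↑) '' (Subsemigroup.closure {s} : Set S)) ∧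
      (v : WithOne S) ∈ insert 1 ((↑) '' (Subsemigroup.closure {s} : Set S)) ∧
      w ∈ insert 1 ((↑) '' (Subsemigroup.closure {s} : Set S))) := fun s hs =>
    hne (mul_mul_comm_of_mem_closure (by rintro _ rfl _ rfl; rfl) hs.1 hs.2.1 hs.2.2)
  have hwC : w = 1 ∨ ∃ w' ∈ C, w' ∉ J.carrier ∧ w = w' := by
    rcases hw with rfl | ⟨w', hw', rfl⟩
    · exact Or.inl rfl
    · exact Or.inr ⟨w', hw', fun h => hcJ (J.mem_of_mul_mul_eq h hc.symm), rfl⟩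
  -- if the first factor of a product outside `J` ends with `a`, the others are powers of `a`
  have key : ∀ (x y s : S), y ∈ C → y ∉ J.carrier → s ∉ J.carrier →
      (x : WithOne S) * w * y = s → endsA (x : WithOne S) → w ∈ A ∧ y ∈ Subsemigroup.closure {a} := by
    intro x y s hy hyJ hs hxy hx
    have hwA : w ∈ A := by
      rcases hwC with rfl | ⟨w, hwC, hwJ, rfl⟩
      · exact Or.inl rfl
      · refine Or.inr ⟨w, ((hstart w hwC).resolve_left hwJ).resolve_right fun h => hs ?_, rfl⟩
        obtain ⟨t, ht⟩ := h
        exact hJ _ _ s hx ⟨t * y, by rw [← mul_assoc, ← ht]⟩ (by rw [← mul_assoc]; exact hxy)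
    refine ⟨hwA, ((hstart y hy).resolve_left hyJ).resolve_right fun h => hs (hJ _ _ s ?_ h hxy)⟩
    rcases hwA with rfl | ⟨w, hw, rfl⟩
    · rwa [mul_one]
    · obtain ⟨t, ht⟩ := hAend w ‹_›
      exact ⟨x * t, by rw [ht, mul_assoc]⟩
  -- If u and v are powers of b, so is w, for otherwise w * v contains a * b. If one of them ends
  -- with a, applying `key` in both orders makes u, v and w powers of a or 1. Either way the
  -- successor has equal components.
  rcases ((hend u huC).resolve_left huJ) with hu | hu
  · rcases ((hend v hvC).resolve_left hvJ) with hv | hv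
    · refine hcomm b ⟨Or.inr ⟨u, hu, rfl⟩, Or.inr ⟨v, hv, rfl⟩, ?_⟩
      rcases hwC with rfl | ⟨w, hwC, hwJ, rfl⟩
      · exact Or.inl rfl
      · refine Or.inr ⟨w, ((hend w hwC).resolve_left hwJ).resolve_right fun h => hcJ ?_, rfl⟩
        obtain ⟨t, ht⟩ := h
        exact hJ _ _ c ⟨u * t, by rw [mul_assoc, ← ht]⟩ (hBstart v hv) hc.symm
    · obtain ⟨h1, h2⟩ := key v u d huC huJ hdJ hd.symm hv
      obtain ⟨-, h3⟩ := key u v c hvC hvJ hcJ hc.symm (hAend u h2)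
      exact hcomm a ⟨Or.inr ⟨u, h2, rfl⟩, Or.inr ⟨v, h3, rfl⟩, h1⟩
  · obtain ⟨h1, h2⟩ := key u v c hvC hvJ hcJ hc.symm hu
    obtain ⟨-, h3⟩ := key v u d huC huJ hdJ hd.symm (hAend v h2)
    exact hcomm a ⟨Or.inr ⟨u, h3, rfl⟩, Or.inr ⟨v, h2, rfl⟩, h1⟩

end

/-! ### Layers of a principal series -/

namespace PrincipalSeries

variable {S : Type u} [Semigroup S] (P : PrincipalSeries S)

theorem ideal_antitone : Antitone fun i => (P.ideal i).carrier :=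
  Fin.antitone_iff_succ_le.2 fun i => (P.ssubset i).subset

theorem layer_nonempty (i : Fin P.length) : (P.layer i).Nonempty :=
  Set.nonempty_of_ssubset (P.ssubset i)

theorem exists_mem_layer (s : S) : ∃ i, s ∈ P.layer i := by
  have h : ∀ j, s ∈ (P.ideal j).carrier ∨ ∃ i, s ∈ P.layer i := by
    intro j
    induction j using Fin.induction with
    | zero => left; rw [P.first]; trivial
    | succ i ih =>
      rcases ih with ih | ih
      · by_cases hs : s ∈ (P.ideal i.succ).carrier
        exacts [Or.inl hs, Or.inr ⟨i, ih, hs⟩]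
      · exact Or.inr ih
  refine (h (Fin.last _)).resolve_left ?_
  rw [P.last]
  exact Set.notMem_empty s

theorem le_of_mem_layer_of_mem_upper {i j : Fin P.length} {s : S} (hi : s ∈ P.layer i)
    (hj : s ∈ (P.upper j).carrier) : j ≤ i := by
  by_contra! h
  exact hi.2 (P.ideal_antitone (Fin.succ_le_castSucc_iff.2 h) hj)

theorem lt_of_mem_layer_of_mem_lower {i j : Fin P.length} {s : S} (hi : s ∈ P.layer i)
    (hj : s ∈ (P.lower j).carrier) : j < i := by
  by_contra! h
  exact hi.2 (P.ideal_antitone (Fin.succ_le_succ_iff.2 h) hj)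

/-- The layer `Sᵢ \ Sᵢ₊₁`, as a subset of `S¹`. -/
def layerOne (i : Fin P.length) : Set (WithOne S) := (↑) '' P.layer i

theorem coe_mem_layerOne {i : Fin P.length} {s : S} :
    (s : WithOne S) ∈ P.layerOne i ↔ s ∈ P.layer i :=
  WithOne.coe_injective.mem_set_image

/-- By maximality of the chain, adjoining to the lower ideal all multiples of a already gives the
whole upper ideal. -/
theorem exists_mul_mul_eq {i : Fin P.length} {a b : S} (ha : a ∈ P.layer i) (hb : b ∈ P.layer i) :
    ∃ u v : WithOne S, u * (a : WithOne S) * v = b := by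
  let J : SgIdeal S :=
    { carrier := (P.lower i).carrier ∪ {s | ∃ u v : WithOne S, u * (a : WithOne S) * v = s}
      mul_mem_left := by
        rintro s t (ht | ⟨u, v, h⟩)
        · exact Or.inl ((P.lower i).mul_mem_left _ ht)
        · exact Or.inr ⟨s * u, v, by rw [WithOne.coe_mul, ← h]; simp only [mul_assoc]⟩
      mul_mem_right := by
        rintro s t (ht | ⟨u, v, h⟩)
        · exact Or.inl ((P.lower i).mul_mem_right _ ht)
        · exact Or.inr ⟨u, v * s, by rw [WithOne.coe_mul, ← h]; simp only [mul_assoc]⟩ }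
  have hJa : a ∈ J.carrier := Or.inr ⟨1, 1, by simp⟩
  have hJi : J.carrier ⊆ (P.ideal i.castSucc).carrier := by
    rintro s (hs | ⟨u, v, hs⟩)
    exacts [(P.ssubset i).subset hs, (P.upper i).mem_of_mul_mul_eq ha.1 hs]
  rcases P.maximal i J Set.subset_union_left hJi with h | h
  · exact (ha.2 (h ▸ hJa : a ∈ (P.ideal i.succ).carrier)).elim
  · have hbJ : b ∈ J.carrier := h ▸ hb.1
    exact hbJ.resolve_left hb.2

theorem isJClass_layerOne (i : Fin P.length) : IsJClass (P.layerOne i) := by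
  rintro _ ⟨a, ha, rfl⟩ b
  constructor
  · rintro ⟨b, hb, rfl⟩
    exact ⟨P.exists_mul_mul_eq ha hb, P.exists_mul_mul_eq hb ha⟩
  · rintro ⟨⟨u, v, rfl⟩, u', v', h⟩
    obtain ⟨s, hs⟩ := exists_coe_eq_mul_coe_mul u v a
    rw [hs] at h ⊢
    exact ⟨s, ⟨(P.upper i).mem_of_mul_mul_eq ha.1 hs,
      fun h' => ha.2 ((P.lower i).mem_of_mul_mul_eq h' h)⟩, rfl⟩

theorem layerOne_subset (i : Fin P.length) : P.layerOne i ⊆ {1}ᶜ := by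
  rintro _ ⟨a, -, rfl⟩
  exact WithOne.coe_ne_one

/-- Persistent pairs in the layer are adjacent modulo the next ideal, so `mul_notMem_of_adj` keeps
their products out of it. -/
theorem productsStay_layerOne [Finite S] (h : PseudoNilpotent S) (i : Fin P.length) :
    ProductsStay (P.layerOne i) := by
  have key : ∀ Q : Set (WithOne S × WithOne S), Persistent Set.univ Q →
      (∀ p ∈ Q, p.1 ∈ P.layerOne i ∧ p.2 ∈ P.layerOne i) → ∀ p ∈ Q, ∃ a b : S,
        p = ((a : WithOne S), (b : WithOne S)) ∧ a ∈ P.layer i ∧ b ∈ P.layer i ∧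
        (upperNonNilpotentGraph (P.lower i).ReesFactor).Adj
          ((P.lower i).toFactor a) ((P.lower i).toFactor b) := by
    rintro Q hQ hQK ⟨x, y⟩ hp
    obtain ⟨⟨a, ha, rfl⟩, b, hb, rfl⟩ := hQK _ hp
    refine ⟨a, b, rfl, ha, hb, h.adj_toFactor (P.lower i) hQ (fun c d hcd => ?_) hp⟩
    exact ⟨(P.coe_mem_layerOne.1 (hQK _ hcd).1).2, (P.coe_mem_layerOne.1 (hQK _ hcd).2).2⟩
  intro Q hQ hQK p hp
  obtain ⟨a, b, rfl, ha, hb, hab⟩ := key Q hQ hQK p hp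
  exact ⟨⟨_, ⟨(P.upper i).mul_mem_left _ hb.1, mul_notMem_of_adj _ hab⟩, WithOne.coe_mul _ _⟩,
    ⟨_, ⟨(P.upper i).mul_mem_left _ ha.1, mul_notMem_of_adj _ hab.symm⟩, WithOne.coe_mul _ _⟩⟩

/-- The layer `Sᵢ \ Sᵢ₊₁` is closed under products and is not a single `ℋ`-class. -/
structure IsThick (i : Fin P.length) : Prop extends IsClosedJClass (P.layerOne i) where
  exists_not_rel : ∃ a ∈ P.layerOne i, ∃ b ∈ P.layerOne i, ¬ RRel a b ∨ ¬ LRel a b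

theorem isThick_of_persistent [Finite S] (h : PseudoNilpotent S) {i : Fin P.length}
    {Q : Set (WithOne S × WithOne S)} (hQ : Persistent Set.univ Q)
    (hQK : ∀ p ∈ Q, p.1 ∈ P.layerOne i ∧ p.2 ∈ P.layerOne i) (hne : Q.Nonempty) :
    P.IsThick i := by
  have := finite_withOne S
  obtain ⟨h1, h2⟩ := (P.isJClass_layerOne i).mul_mem_of_persistent (P.productsStay_layerOne h i)
    h.noCommutingPairs (fun a ha b => (mul_mem_compl_one (P.layerOne_subset i ha) b).1) hQ hQK hne
  exact ⟨⟨P.isJClass_layerOne i, h1, (P.layer_nonempty i).image _⟩, h2⟩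

theorem IsRoot.isThick [Finite S] (h : PseudoNilpotent S) {i : Fin P.length} (hi : P.IsRoot i) :
    P.IsThick i := by
  obtain ⟨Q, hne, hQ, hQC⟩ := exists_persistent_of_not_malcevNilpotent
    (P.upper i).toSubsemigroup (P.lower i)
    ((P.lower i).restrict (P.upper i).toSubsemigroup).reesMk (SgIdeal.reesMk_surjective _)
    (fun a b ha hb => (SgIdeal.reesMk_eq_iff _).2 (Or.inr ⟨ha, hb⟩)) hi.1
  exact P.isThick_of_persistent h (hQ.mono (Set.subset_univ _)) hQC hne

variable {P}

theorem IsThick.mem_F_union_layer_iff {i : Fin P.length} (hi : P.IsThick i) {s : S} :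
    s ∈ P.F i ∪ P.layer i ↔ IsAbove (P.layerOne i) (s : WithOne S) := by
  constructor
  · rintro (⟨-, j, hj, h⟩ | h)
    · rcases h with h | h
      · exact ⟨1, j, s * j, ⟨(P.upper i).mul_mem_left _ hj, h⟩, by simp⟩
      · exact ⟨j, 1, j * s, ⟨(P.upper i).mul_mem_right _ hj, h⟩, by simp⟩
    · exact .of_mem (P.coe_mem_layerOne.2 h)
  · intro h
    by_cases hs : s ∈ (P.upper i).carrier
    · refine Or.inr ⟨hs, fun hs' => ?_⟩
      obtain ⟨u, v, k, hk, huv⟩ := h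
      exact hk.2 ((P.lower i).mem_of_mul_mul_eq hs' huv.symm)
    · obtain ⟨k, hk⟩ := P.layer_nonempty i
      have := hi.above_mul_mem h (P.coe_mem_layerOne.2 hk)
      rw [← WithOne.coe_mul, P.coe_mem_layerOne] at this
      exact Or.inl ⟨hs, k, hk.1, Or.inl this.2⟩

theorem isAbove_of_mem_layer {i j : Fin P.length} {s t : S}
    (h : IsAbove (P.layerOne i) (s : WithOne S)) (hs : s ∈ P.layer j) (ht : t ∈ P.layer j) :
    IsAbove (P.layerOne i) (t : WithOne S) := by
  obtain ⟨u, v, huv⟩ := P.exists_mul_mul_eq ht hs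
  rw [← huv] at h
  exact h.of_mul_mul

/-- Being above the layer is constant on layers, and it forces the index condition j ≤ i. Stems can
therefore be handled purely by divisibility. -/
theorem IsThick.mem_stem_iff {i : Fin P.length} (hi : P.IsThick i) {s : S} :
    s ∈ P.stem i ↔ IsAbove (P.layerOne i) (s : WithOne S) := by
  simp only [stem, Set.mem_iUnion, exists_prop]
  constructor
  · rintro ⟨j, ⟨-, hj⟩, hs⟩
    exact hi.mem_F_union_layer_iff.1 (hj hs)
  · intro h
    obtain ⟨j, hj⟩ := P.exists_mem_layer s
    refine ⟨j, ⟨?_, fun t ht => hi.mem_F_union_layer_iff.2 (isAbove_of_mem_layer h hj ht)⟩, hj⟩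
    obtain ⟨u, v, k, hk, huv⟩ := h
    exact P.le_of_mem_layer_of_mem_upper hk ((P.upper j).mem_of_mul_mul_eq hj.1 huv.symm)

end PrincipalSeries

/-! ### Rees coordinates of a closed layer -/

namespace PrincipalSeries

variable {S : Type u} [Semigroup S] {P : PrincipalSeries S} {i : Fin P.length}

namespace IsThick

variable (hi : P.IsThick i)

include hi

theorem mul_mem_layer {a b : S} (ha : a ∈ P.layer i) (hb : b ∈ P.layer i) : a * b ∈ P.layer i := by
  rw [← P.coe_mem_layerOne, WithOne.coe_mul]
  exact hi.mul_mem _ (P.coe_mem_layerOne.2 ha) _ (P.coe_mem_layerOne.2 hb)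

variable [Finite S]

theorem exists_mul_mul_right {a b : S} (ha : a ∈ P.layer i) (hb : b ∈ P.layer i) :
    ∃ t ∈ P.layer i, a * b * t = a := by
  have := finite_withOne S
  have ha' := P.coe_mem_layerOne.2 ha
  have hb' := P.coe_mem_layerOne.2 hb
  obtain ⟨-, t, ht⟩ := hi.rRel_mul ha' (.of_mem hb')
  -- The multiplier t may be 1 or lie outside the layer; t * b * t serves equally well and lies in
  -- the layer.
  have h1 : (a : WithOne S) * b * (t * b * t) = a := by
    simp only [← mul_assoc, ht]
  obtain ⟨s, hs, hs'⟩ : t * b * t ∈ P.layerOne i :=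
    hi.isJClass.mem_of_le_of_le (u' := a * b) (v' := 1) hb' rfl (by rwa [mul_one, h1])
  refine ⟨s, hs, WithOne.coe_injective ?_⟩
  rw [WithOne.coe_mul, WithOne.coe_mul, hs', h1]

theorem exists_mul_mul_left {a b : S} (ha : a ∈ P.layer i) (hb : b ∈ P.layer i) :
    ∃ t ∈ P.layer i, t * (b * a) = a := by
  have := finite_withOne S
  have ha' := P.coe_mem_layerOne.2 ha
  have hb' := P.coe_mem_layerOne.2 hb
  obtain ⟨-, t, ht⟩ := hi.lRel_mul ha' (.of_mem hb')
  have h1 : t * (b : WithOne S) * t * (b * a) = a := by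
    simp only [mul_assoc, ht]
  obtain ⟨s, hs, hs'⟩ : t * b * t ∈ P.layerOne i :=
    hi.isJClass.mem_of_le_of_le (u' := 1) (v' := b * a) hb' rfl (by rwa [one_mul, h1])
  refine ⟨s, hs, WithOne.coe_injective ?_⟩
  rw [WithOne.coe_mul, WithOne.coe_mul, hs', h1]

theorem exists_idempotent : ∃ e ∈ P.layer i, e * e = e := by
  have := finite_withOne S
  obtain ⟨k, hk⟩ := hi.nonempty
  obtain ⟨n, hn, hid⟩ := exists_pow_idempotent k
  have hpow : k ^ n ∈ P.layerOne i := by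
    clear hid
    induction n, hn using Nat.le_induction with
    | base => simpa using hk
    | succ n _ ih => rw [pow_succ]; exact hi.mul_mem _ ih _ hk
  obtain ⟨e, he, he'⟩ := hpow
  exact ⟨e, he, WithOne.coe_injective (by rw [WithOne.coe_mul, he', hid])⟩

/-- The maximal subgroup at an idempotent of the layer. -/
theorem exists_group {e : S} (he : e ∈ P.layer i) (hee : e * e = e) :
    ∃ _ : Group {x : S // x ∈ P.layer i ∧ e * x = x ∧ x * e = x},
      (∀ x y : {x : S // x ∈ P.layer i ∧ e * x = x ∧ x * e = x},
        ((x * y : {x : S // x ∈ P.layer i ∧ e * x = x ∧ x * e = x}) : S) = x * y) ∧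
      ((1 : {x : S // x ∈ P.layer i ∧ e * x = x ∧ x * e = x}) : S) = e := by
  have hinv : ∀ x : {x : S // x ∈ P.layer i ∧ e * x = x ∧ x * e = x},
      ∃ y : {x : S // x ∈ P.layer i ∧ e * x = x ∧ x * e = x}, (y : S) * x = e := by
    rintro ⟨x, hx, hex, hxe⟩
    obtain ⟨t, ht, h⟩ := hi.exists_mul_mul_left he hx
    refine ⟨⟨e * t * e, hi.mul_mem_layer (hi.mul_mem_layer he ht) he, ?_, ?_⟩, ?_⟩
    · rw [← mul_assoc, ← mul_assoc, hee]
    · rw [mul_assoc, hee]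
    · rw [mul_assoc, hex, mul_assoc, ← hxe, h, hee]
  choose inv hinv using hinv
  let _ : Mul {x : S // x ∈ P.layer i ∧ e * x = x ∧ x * e = x} := ⟨fun x y =>
    ⟨x * y, hi.mul_mem_layer x.2.1 y.2.1, by rw [← mul_assoc, x.2.2.1],
      by rw [mul_assoc, y.2.2.2]⟩⟩
  let _ : One {x : S // x ∈ P.layer i ∧ e * x = x ∧ x * e = x} := ⟨⟨e, he, hee, hee⟩⟩
  let _ : Inv {x : S // x ∈ P.layer i ∧ e * x = x ∧ x * e = x} := ⟨inv⟩
  exact ⟨Group.ofLeftAxioms (fun x y z => Subtype.ext (mul_assoc _ _ _))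
    (fun x => Subtype.ext x.2.2.1) (fun x => Subtype.ext (hinv x)), fun _ _ => rfl, rfl⟩

/-- With e an idempotent of the layer, G is the maximal subgroup at e, and I and Λ are the
idempotents of the ℒ-class and the ℛ-class of e. The triple (g, k, l) is k * g * l; the sandwich
entry l * k lies in G, so it is never zero. -/
theorem exists_reesCoordinates :
    ∃ (G I Λ : Type u) (_ : Group G) (c : P.ReesCoordinates i G I Λ),
      ∀ (g : G) (k : I) (l : Λ) (g' : G) (k' : I) (l' : Λ),
        (RRel ((c.elt (g, k, l) : S) : WithOne S) ((c.elt (g', k', l') : S) : WithOne S) ↔ k = k') ∧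
        (LRel ((c.elt (g, k, l) : S) : WithOne S) ((c.elt (g', k', l') : S) : WithOne S) ↔
          l = l') := by
  have := finite_withOne S
  obtain ⟨e, he, hee⟩ := hi.exists_idempotent
  obtain ⟨grp, hmul, hone⟩ := hi.exists_group he hee
  let G := {x : S // x ∈ P.layer i ∧ e * x = x ∧ x * e = x}
  let I := {x : S // x ∈ P.layer i ∧ x * x = x ∧ x * e = x}
  let Λ := {x : S // x ∈ P.layer i ∧ x * x = x ∧ e * x = x}
  have hG : ∀ x ∈ P.layer i, e * x = x → x * e = x → x * x = x → x = e := by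
    intro x hx h1 h2 h3
    have h4 : (⟨x, hx, h1, h2⟩ : G) * ⟨x, hx, h1, h2⟩ = ⟨x, hx, h1, h2⟩ :=
      Subtype.ext (by rw [hmul]; exact h3)
    rw [mul_eq_left] at h4
    rw [← hone, ← h4]
  have hI : ∀ k : I, e * k = e := fun k =>
    hG _ (hi.mul_mem_layer he k.2.1) (by rw [← mul_assoc, hee]) (by rw [mul_assoc, k.2.2.2])
      (by rw [mul_assoc, ← mul_assoc k.1, k.2.2.2, k.2.2.1])
  have hΛ : ∀ l : Λ, l * e = e := fun l =>
    hG _ (hi.mul_mem_layer l.2.1 he) (by rw [← mul_assoc, l.2.2.2]) (by rw [mul_assoc, hee])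
      (by rw [mul_assoc, ← mul_assoc e, l.2.2.2, ← mul_assoc, l.2.2.1])
  have hgi : ∀ g : G, (g : S) * (g⁻¹ : G) = e := fun g => by rw [← hmul, mul_inv_cancel, hone]
  have hig : ∀ g : G, ((g⁻¹ : G) : S) * g = e := fun g => by rw [← hmul, inv_mul_cancel, hone]
  let φ : G × I × Λ → P.layer i := fun x =>
    ⟨x.2.1 * x.1 * x.2.2, hi.mul_mem_layer (hi.mul_mem_layer x.2.1.2.1 x.1.2.1) x.2.2.2.1⟩
  have hφr : ∀ x : G × I × Λ, (φ x : S) * e = x.2.1 * x.1 := fun ⟨g, k, l⟩ => by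
    change (k : S) * g * l * e = k * g
    rw [mul_assoc, hΛ, mul_assoc, g.2.2.2]
  have hφl : ∀ x : G × I × Λ, e * (φ x : S) = x.1 * x.2.2 := fun ⟨g, k, l⟩ => by
    change e * ((k : S) * g * l) = g * l
    rw [← mul_assoc, ← mul_assoc, hI, g.2.2.1]
  have hφ : Function.Bijective φ := by
    constructor
    · rintro ⟨g, k, l⟩ ⟨g', k', l'⟩ h
      have hr := hφr (g, k, l)
      have hl := hφl (g, k, l)
      rw [h, hφr] at hr
      rw [h, hφl] at hl
      simp only at hr hl
      obtain rfl : g' = g := by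
        have h1 := congrArg (e * ·) hr
        simp only [← mul_assoc, hI, g.2.2.1, g'.2.2.1] at h1
        exact Subtype.ext h1
      have h2 := congrArg (· * ((g'⁻¹ : G) : S)) hr
      have h3 := congrArg (((g'⁻¹ : G) : S) * ·) hl
      simp only [mul_assoc, hgi, k.2.2.2, k'.2.2.2] at h2
      simp only [← mul_assoc, hig, l.2.2.2, l'.2.2.2] at h3
      rw [Subtype.ext h2, Subtype.ext h3]
    · rintro ⟨x, hx⟩
      -- If y is the inverse of e * x * e in G, then x has coordinates (e * x * e, x * y, y * x).
      let g : G := ⟨e * x * e, hi.mul_mem_layer (hi.mul_mem_layer he hx) he,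
        by rw [← mul_assoc, ← mul_assoc, hee], by rw [mul_assoc, hee]⟩
      have h1 : ((g⁻¹ : G) : S) * x * e = e :=
        calc ((g⁻¹ : G) : S) * x * e = ((g⁻¹ : G) : S) * e * x * e := by rw [(g⁻¹ : G).2.2.2]
          _ = ((g⁻¹ : G) : S) * (e * x * e) := by simp only [mul_assoc]
          _ = e := hig g
      have h2 : e * x * ((g⁻¹ : G) : S) = e :=
        calc e * x * ((g⁻¹ : G) : S) = e * x * (e * (g⁻¹ : G)) := by rw [(g⁻¹ : G).2.2.1]
          _ = e * x * e * (g⁻¹ : G) := by simp only [mul_assoc]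
          _ = e := hgi g
      have hg := (g⁻¹ : G).2
      generalize ((g⁻¹ : G) : S) = y at h1 h2 hg
      obtain ⟨hy, hey, hye⟩ := hg
      have hk : x * y * (x * y) = x * y :=
        calc x * y * (x * y) = x * y * (x * (e * y)) := by rw [hey]
          _ = x * (y * x * e) * y := by simp only [mul_assoc]
          _ = x * y := by rw [h1, mul_assoc, hey]
      have hl : y * x * (y * x) = y * x :=
        calc y * x * (y * x) = y * e * x * (y * x) := by rw [hye]
          _ = y * (e * x * y) * x := by simp only [mul_assoc]
          _ = y * x := by rw [h2, hye]
      refine ⟨(g, ⟨x * y, hi.mul_mem_layer hx hy, hk, by rw [mul_assoc, hye]⟩,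
        ⟨y * x, hi.mul_mem_layer hy hx, hl, by rw [← mul_assoc, hey]⟩), Subtype.ext ?_⟩
      obtain ⟨t, ht, hxt⟩ := hi.exists_mul_mul_right hx hy
      calc x * y * (e * x * e) * (y * x) = x * (y * e) * x * (e * y) * x := by
            simp only [mul_assoc]
        _ = x * y * (x * y) * x := by rw [hye, hey]; simp only [mul_assoc]
        _ = x * y * (x * y * t) := by rw [hk, hxt]
        _ = x := by rw [← mul_assoc, hk, hxt]
  let c : P.ReesCoordinates i G I Λ :=
    { p := fun l k => ((⟨l * k, hi.mul_mem_layer l.2.1 k.2.1, by rw [← mul_assoc, l.2.2.2],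
        by rw [mul_assoc, k.2.2.2]⟩ : G) : WithZero G)
      elt := Equiv.ofBijective φ hφ
      mul_of_zero := fun g g' k k' l l' h => (WithZero.coe_ne_zero h).elim
      mul_of_coe := fun g g' h k k' l l' hp => by
        rw [WithZero.coe_inj] at hp
        subst hp
        change (k : S) * g * l * (k' * g' * l') = k * ((_ * _ : G) : S) * l'
        rw [hmul, hmul]
        simp only [mul_assoc]
      row_regular := fun l => ⟨⟨e, he, hee, hee⟩, WithZero.coe_ne_zero⟩
      col_regular := fun k => ⟨⟨e, he, hee, hee⟩, WithZero.coe_ne_zero⟩ }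
  have hR : ∀ x : G × I × Λ, RRel ((x.2.1 : S) : WithOne S) ((c.elt x : S) : WithOne S) := by
    intro x
    change RRel _ (((x.2.1 * x.1 * x.2.2 : S)) : WithOne S)
    rw [mul_assoc, WithOne.coe_mul]
    exact hi.rRel_mul (P.coe_mem_layerOne.2 x.2.1.2.1)
      (.of_mem (P.coe_mem_layerOne.2 (hi.mul_mem_layer x.1.2.1 x.2.2.2.1)))
  have hL : ∀ x : G × I × Λ, LRel ((x.2.2 : S) : WithOne S) ((c.elt x : S) : WithOne S) := by
    intro x
    change LRel _ (((x.2.1 * x.1 * x.2.2 : S)) : WithOne S)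
    rw [WithOne.coe_mul]
    exact hi.lRel_mul (P.coe_mem_layerOne.2 x.2.2.2.1)
      (.of_mem (P.coe_mem_layerOne.2 (hi.mul_mem_layer x.2.1.2.1 x.1.2.1)))
  refine ⟨G, I, Λ, grp, c, fun g k l g' k' l' => ⟨⟨fun h => ?_, ?_⟩, fun h => ?_, ?_⟩⟩
  · obtain ⟨⟨s, hs⟩, -⟩ := ((hR (g, k, l)).trans h).trans (hR (g', k', l')).symm
    apply Subtype.ext
    have h1 : (k : S) * k' = k := by
      rw [← k.2.2.2, mul_assoc, hI]
    rw [← h1]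
    apply WithOne.coe_injective
    simp only at hs
    rw [WithOne.coe_mul, ← hs, ← mul_assoc, ← WithOne.coe_mul, k.2.2.1]
  · rintro rfl
    exact (hR (g, k, l)).symm.trans (hR (g', k, l'))
  · obtain ⟨⟨s, hs⟩, -⟩ := ((hL (g, k, l)).trans h).trans (hL (g', k', l')).symm
    apply Subtype.ext
    have h1 : (l' : S) * l = l := by
      rw [← l.2.2.2, ← mul_assoc, hΛ]
    rw [← h1]
    apply WithOne.coe_injective
    simp only at hs
    rw [WithOne.coe_mul, ← hs, mul_assoc, ← WithOne.coe_mul, l.2.2.1]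
  · rintro rfl
    exact (hL (g, k, l)).symm.trans (hL (g', k', l))

end IsThick

end PrincipalSeries

/-! ### The pseudo-nilpotent homomorphism of a closed layer -/

namespace PrincipalSeries

variable {S : Type u} [Semigroup S] {P : PrincipalSeries S} {i : Fin P.length}

theorem notMem_lower_of_isAbove {s : S} (h : IsAbove (P.layerOne i) (s : WithOne S)) :
    s ∉ (P.lower i).carrier := by
  intro hs
  obtain ⟨u, v, k, hk, huv⟩ := h
  exact hk.2 ((P.lower i).mem_of_mul_mul_eq hs huv.symm)

namespace IsThick

variable [Finite S] (hi : P.IsThick i)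

include hi

theorem exists_persistent {a b u : WithOne S} (ha : IsAbove (P.layerOne i) a)
    (hb : IsAbove (P.layerOne i) b) (hu : u ∈ P.layerOne i)
    (hab : ¬ RRel (a * u) (b * u) ∨ ¬ LRel (u * a) (u * b)) :
    ∃ Q : Set (WithOne S × WithOne S), Persistent Set.univ Q ∧
      (∀ p ∈ Q, IsAbove (P.layerOne i) p.1 ∧ IsAbove (P.layerOne i) p.2) ∧ (a, b) ∈ Q := by
  have := finite_withOne S
  have := finite_mulOpposite (WithOne S)
  rcases hab with hab | hab
  · exact ⟨_, hi.persistent_of_not_rRel hu, fun p hp => ⟨hp.1, hp.2.1⟩, ha, hb, u, hu, hab⟩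
  · refine ⟨_, (hi.op.persistent_of_not_rRel (u := .op u) hu).unop, ?_,
      Or.inl ⟨ha.op, hb.op, .op u, hu, fun h => hab (rRel_op_iff.1 h)⟩⟩
    have key : ∀ s, IsAbove (MulOpposite.unop ⁻¹' P.layerOne i) (MulOpposite.op s) →
        IsAbove (P.layerOne i) s := by
      rintro s ⟨x, y, h⟩
      exact ⟨y.unop, x.unop, by simpa [mul_assoc] using h⟩
    rintro p (hp | hp)
    exacts [⟨key _ hp.1, key _ hp.2.1⟩, ⟨key _ hp.2.1, key _ hp.1⟩]

variable (h : PseudoNilpotent S)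

include h

theorem adj_toFactor_of_not_rel {a b u : S} (ha : IsAbove (P.layerOne i) (a : WithOne S))
    (hb : IsAbove (P.layerOne i) (b : WithOne S)) (hu : u ∈ P.layer i)
    (hab : ¬ RRel (a * u : WithOne S) (b * u) ∨ ¬ LRel (u * a : WithOne S) (u * b)) :
    (upperNonNilpotentGraph (P.lower i).ReesFactor).Adj
      ((P.lower i).toFactor a) ((P.lower i).toFactor b) := by
  obtain ⟨Q, hQ, hQA, hmem⟩ := hi.exists_persistent ha hb (P.coe_mem_layerOne.2 hu) hab
  exact h.adj_toFactor _ hQ (fun c d hcd => ⟨notMem_lower_of_isAbove (hQA _ hcd).1,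
    notMem_lower_of_isAbove (hQA _ hcd).2⟩) hmem

theorem adj_of_not_rel {a b u : S} (ha : IsAbove (P.layerOne i) (a : WithOne S))
    (hb : IsAbove (P.layerOne i) (b : WithOne S)) (hu : u ∈ P.layer i)
    (hab : ¬ RRel (a * u : WithOne S) (b * u) ∨ ¬ LRel (u * a : WithOne S) (u * b)) :
    (upperNonNilpotentGraph S).Adj a b := by
  obtain ⟨Q, hQ, -, hmem⟩ := hi.exists_persistent ha hb (P.coe_mem_layerOne.2 hu) hab
  exact h.adj hQ hmem

theorem rRel_mul_mul' {a : S} {u v : WithOne S} (ha : IsAbove (P.layerOne i) (a : WithOne S))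
    (hu : u ∈ P.layerOne i) (hv : v ∈ P.layerOne i) : RRel (a * u) (a * v) :=
  have := finite_withOne S
  hi.rRel_mul_mul h.noCommutingPairs (fun _ ha b => mul_mem_compl_one ha b)
    (P.layerOne_subset i) ha WithOne.coe_ne_one hu hv

theorem lRel_mul_mul' {a : S} {u v : WithOne S} (ha : IsAbove (P.layerOne i) (a : WithOne S))
    (hu : u ∈ P.layerOne i) (hv : v ∈ P.layerOne i) : LRel (u * a) (v * a) :=
  have := finite_withOne S
  hi.lRel_mul_mul h.noCommutingPairs (fun _ ha b => mul_mem_compl_one ha b)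
    (P.layerOne_subset i) ha WithOne.coe_ne_one hu hv

/-- Every element of ⟨a, x⟩ is a power of a or lies in the ℋ-class of x, which absorbs such powers.
Powers of a commute, so an edge would put a persistent set inside this ℋ-class, against
`NoCommutingPairs.not_mem_of_hClass`. -/
theorem not_adj_toFactor_of_rel {a x u : S} (ha : IsAbove (P.layerOne i) (a : WithOne S))
    (hx : x ∈ P.layer i) (hu : u ∈ P.layer i) (hR : RRel (a * u : WithOne S) x)
    (hL : LRel (u * a : WithOne S) x) :
    ¬ (upperNonNilpotentGraph (P.lower i).ReesFactor).Adj
      ((P.lower i).toFactor a) ((P.lower i).toFactor x) := by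
  have := finite_withOne S
  intro hadj
  have hx' := P.coe_mem_layerOne.2 hx
  have hu' := P.coe_mem_layerOne.2 hu
  let H : Set (WithOne S) := {z | RRel (x : WithOne S) z ∧ LRel (x : WithOne S) z}
  have hHK : ∀ z ∈ H, z ∈ P.layerOne i := fun z hz => hi.isJClass.mem_of_rRel hx' hz.1
  have hHH : ∀ y ∈ H, ∀ z ∈ H, y * z ∈ H := fun y hy z hz =>
    ⟨hy.1.trans (hi.rRel_mul (hHK y hy) (.of_mem (hHK z hz))),
      hz.2.trans (hi.lRel_mul (hHK z hz) (.of_mem (hHK y hy)))⟩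
  let A : Set (WithOne S) := insert 1 ((↑) '' (Subsemigroup.closure {a} : Set S))
  have hAH : ∀ y ∈ A, ∀ z ∈ H, y * z ∈ H ∧ z * y ∈ H := by
    rintro _ (rfl | ⟨y, hy, rfl⟩) z hz
    · simpa using hz
    · induction hy using Subsemigroup.closure_induction generalizing z with
      | mem y hy =>
        obtain rfl : y = a := hy
        exact ⟨⟨hR.symm.trans (hi.rRel_mul_mul' h ha hu' (hHK z hz)),
          hz.2.trans (hi.lRel_mul (hHK z hz) ha)⟩,
          hz.1.trans (hi.rRel_mul (hHK z hz) ha),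
          hL.symm.trans (hi.lRel_mul_mul' h ha hu' (hHK z hz))⟩
      | mul y y' _ _ ih ih' =>
        rw [WithOne.coe_mul, mul_assoc, ← mul_assoc z]
        exact ⟨(ih _ (ih' z hz).1).1, (ih' _ (ih z hz).2).2⟩
  have hAA : ∀ y ∈ A, ∀ z ∈ A, y * z ∈ A := by
    rintro _ (rfl | ⟨y, hy, rfl⟩) z hz
    · rwa [one_mul]
    · rcases hz with rfl | ⟨z, hz, rfl⟩
      exacts [Or.inr ⟨y, hy, (mul_one _).symm⟩, Or.inr ⟨y * z, mul_mem hy hz, WithOne.coe_mul _ _⟩]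
  have hprod : ∀ y z, (y ∈ A ∨ y ∈ H) → (z ∈ A ∨ z ∈ H) → (y * z ∈ A ∨ y * z ∈ H) ∧
      ((y ∈ H ∨ z ∈ H) → y * z ∈ H) := by
    have aux : ∀ y z, (y ∈ A ∨ y ∈ H) → (z ∈ A ∨ z ∈ H) → (y ∈ H ∨ z ∈ H) → y * z ∈ H := by
      rintro y z hy hz (h' | h')
      · rcases hz with hz | hz
        exacts [(hAH z hz y h').2, hHH y h' z hz]
      · rcases hy with hy | hy
        exacts [(hAH y hy z h').1, hHH y hy z h']
    refine fun y z hy hz => ⟨?_, aux y z hy hz⟩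
    rcases hy with hy' | hy'
    · rcases hz with hz' | hz'
      exacts [Or.inl (hAA y hy' z hz'), Or.inr (aux y z (Or.inl hy') (Or.inr hz') (Or.inr hz'))]
    · exact Or.inr (aux y z (Or.inr hy') hz (Or.inl hy'))
  have hC : ∀ z ∈ (insert 1 ((↑) '' (Subsemigroup.closure {a, x} : Set S)) : Set (WithOne S)),
      z ∈ A ∨ z ∈ H := by
    rintro _ (rfl | ⟨z, hz, rfl⟩)
    · exact Or.inl (Or.inl rfl)
    · induction hz using Subsemigroup.closure_induction with
      | mem z hz =>
        rcases hz with rfl | rfl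
        · exact Or.inl (Or.inr ⟨z, Subsemigroup.subset_closure rfl, rfl⟩)
        · exact Or.inr ⟨.refl _, .refl _⟩
      | mul y z _ _ hy hz =>
        rw [WithOne.coe_mul]
        exact (hprod _ _ hy hz).1
  obtain ⟨Q, ⟨p, hp⟩, hQ, hQC⟩ := exists_persistent_of_adj (P.lower i) hadj
  have hQC' : ∀ p ∈ Q, (p.1 ∈ A ∨ p.1 ∈ H) ∧ (p.2 ∈ A ∨ p.2 ∈ H) := fun p hp =>
    ⟨hC _ (Or.inr (Set.image_mono Set.sdiff_subset (hQC p hp).1)),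
      hC _ (Or.inr (Set.image_mono Set.sdiff_subset (hQC p hp).2))⟩
  obtain ⟨q, hq, hq1, hq2⟩ : ∃ q ∈ Q, q.1 ∈ H ∧ q.2 ∈ H := by
    obtain ⟨-, w, hw, hnext⟩ := hQ p hp
    obtain ⟨h1, h2⟩ := hQC' p hp
    have hw' := hC w hw
    by_cases hall : p.1 ∈ H ∨ w ∈ H ∨ p.2 ∈ H
    · have h3 := hprod _ _ h1 hw'
      have h4 := hprod _ _ h2 hw'
      exact ⟨_, hnext, (hprod _ _ h3.1 h2).2 (by tauto), (hprod _ _ h4.1 h1).2 (by tauto)⟩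
    · push Not at hall
      exact ((hQ _ hnext).1 (mul_mul_comm_of_mem_closure (by rintro _ rfl _ rfl; rfl)
        (h1.resolve_right hall.1) (h2.resolve_right hall.2.2) (hw'.resolve_right hall.2.1))).elim
  obtain ⟨g, hg⟩ := hi.isJClass.exists_regular (hHK _ hq1) (hi.mul_mem _ (hHK _ hq1) _ (hHK _ hq1))
  have hN : ∀ z ∈ H, z * g ∈ ({1}ᶜ : Set (WithOne S)) := fun z hz =>
    (mul_mem_compl_one (P.layerOne_subset i (hHK z hz)) g).1
  refine h.noCommutingPairs.not_mem_of_hClass (W := Set.univ)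
    (Q := {p ∈ Q | p.1 ∈ H ∧ p.2 ∈ H}) ?_ hg
    (fun p hp => ⟨⟨hq1.1.symm.trans hp.2.1.1, hq1.2.symm.trans hp.2.1.2⟩,
      hq1.1.symm.trans hp.2.2.1, hq1.2.symm.trans hp.2.2.2⟩)
    (fun p hp => ⟨hN _ hp.2.1, hN _ hp.2.2⟩) q.2 ⟨hq, hq1, hq2⟩
  rintro p ⟨hp, hp1, hp2⟩
  obtain ⟨hne, w, hw, hnext⟩ := hQ p hp
  have hw' := hC w hw
  exact ⟨hne, w, trivial, hnext,
    (hprod _ _ (hprod _ _ (Or.inr hp1) hw').1 (Or.inr hp2)).2 (Or.inr hp2),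
    (hprod _ _ (hprod _ _ (Or.inr hp2) hw').1 (Or.inr hp1)).2 (Or.inr hp1)⟩

/-- A closed layer that is not a single `ℋ`-class has a pseudo-nilpotent homomorphism, and elements
with different nonzero images under it are adjacent. -/
theorem exists_isPseudoNilpotentHom :
    ∃ (G I Λ : Type u) (_ : Group G) (c : P.ReesCoordinates i G I Λ) (Φ : S → WithZero (I × Λ)),
      P.IsPseudoNilpotentHom c Φ ∧ ∀ a b : S, IsAbove (P.layerOne i) (a : WithOne S) →
        IsAbove (P.layerOne i) (b : WithOne S) → Φ a ≠ Φ b → (upperNonNilpotentGraph S).Adj a b := by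
  have := finite_withOne S
  obtain ⟨G, I, Λ, _, c, hc⟩ := hi.exists_reesCoordinates
  obtain ⟨u, hu⟩ := P.layer_nonempty i
  have hu' := P.coe_mem_layerOne.2 hu
  have hcoord : ∀ y ∈ P.layerOne i, ∃ (k : I) (l : Λ), ∀ g k' l',
      (RRel y ((c.elt (g, k', l') : S) : WithOne S) ↔ k' = k) ∧
      (LRel y ((c.elt (g, k', l') : S) : WithOne S) ↔ l' = l) := by
    rintro _ ⟨y, hy, rfl⟩
    obtain ⟨⟨g, k, l⟩, hx⟩ := c.elt.surjective ⟨y, hy⟩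
    refine ⟨k, l, fun g' k' l' => ?_⟩
    have := hc g k l g' k' l'
    rw [hx] at this
    exact ⟨this.1.trans eq_comm, this.2.trans eq_comm⟩
  -- The image of s records the ℛ-class of s * u and the ℒ-class of u * s; the choice of u is
  -- immaterial because s acts by constants.
  have hΦ : ∀ s : S, ∃ z : WithZero (I × Λ),
      (IsAbove (P.layerOne i) (s : WithOne S) → ∃ e f, z = ((e, f) : I × Λ) ∧ ∀ g k l,
        (RRel (s * u : WithOne S) ((c.elt (g, k, l) : S) : WithOne S) ↔ k = e) ∧
        (LRel (u * s : WithOne S) ((c.elt (g, k, l) : S) : WithOne S) ↔ l = f)) ∧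
      (¬ IsAbove (P.layerOne i) (s : WithOne S) → z = 0) := by
    intro s
    by_cases hs : IsAbove (P.layerOne i) (s : WithOne S)
    · obtain ⟨e, _, he⟩ := hcoord _ (hi.above_mul_mem hs hu')
      obtain ⟨_, f, hf⟩ := hcoord _ (hi.mul_above_mem hs hu')
      exact ⟨((e, f) : I × Λ), fun _ => ⟨e, f, rfl, fun g k l => ⟨(he g k l).1, (hf g k l).2⟩⟩,
        fun h => (h hs).elim⟩
    · exact ⟨0, fun h => (hs h).elim, fun _ => rfl⟩
  choose Φ hΦ hΦ0 using hΦ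
  refine ⟨G, I, Λ, _, c, Φ, ⟨fun a ha => ?_, fun a ha => ?_⟩, fun a b ha hb hab => ?_⟩
  · rw [hi.mem_F_union_layer_iff] at ha
    obtain ⟨e, f, hef, hrel⟩ := hΦ a ha
    refine ⟨e, f, hef, fun g k l => ?_⟩
    have hx := (c.elt (g, k, l)).2
    have hx' := P.coe_mem_layerOne.2 hx
    obtain ⟨h1, h2⟩ := hrel g k l
    constructor
    · rintro hadj heq
      obtain ⟨rfl, rfl⟩ := Prod.mk.inj heq
      exact hi.not_adj_toFactor_of_rel h ha hx hu (h1.2 rfl) (h2.2 rfl) hadj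
    · intro hne
      refine hi.adj_toFactor_of_not_rel h ha (.of_mem hx') hu ?_
      by_contra! hcon
      exact hne (Prod.ext
        (h1.1 (hcon.1.trans (hi.rRel_mul hx' (.of_mem hu')).symm))
        (h2.1 (hcon.2.trans (hi.lRel_mul hx' (.of_mem hu')).symm)))
  · rw [hi.mem_F_union_layer_iff] at ha
    exact hΦ0 a ha
  · obtain ⟨e, f, hef, hrel⟩ := hΦ a ha
    obtain ⟨e', f', hef', hrel'⟩ := hΦ b hb
    refine hi.adj_of_not_rel h ha hb hu ?_
    by_contra! hcon
    have g : G := 1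
    have he : e' = e := (hrel 1 e' f').1.1 (hcon.1.trans ((hrel' 1 e' f').1.2 rfl))
    have hf : f' = f := (hrel 1 e' f').2.1 (hcon.2.trans ((hrel' 1 e' f').2.2 rfl))
    exact hab (by rw [hef, hef', he, hf])

/-- Elements acting differently are adjacent. Two that act alike have a common neighbour in the
layer, since the layer is not a single ℋ-class. -/
theorem reachable {a b : S} (ha : IsAbove (P.layerOne i) (a : WithOne S))
    (hb : IsAbove (P.layerOne i) (b : WithOne S)) : (upperNonNilpotentGraph S).Reachable a b := by
  have := finite_withOne S
  obtain ⟨u, hu⟩ := P.layer_nonempty i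
  have hu' := P.coe_mem_layerOne.2 hu
  let rel : S → S → Prop := fun a b =>
    RRel (a * u : WithOne S) (b * u) ∧ LRel (u * a : WithOne S) (u * b)
  have hadj : ∀ a b : S, IsAbove (P.layerOne i) (a : WithOne S) →
      IsAbove (P.layerOne i) (b : WithOne S) → ¬ rel a b → (upperNonNilpotentGraph S).Adj a b :=
    fun a b ha hb hab => hi.adj_of_not_rel h ha hb hu (not_and_or.1 hab)
  obtain ⟨x, hx, hax⟩ : ∃ x ∈ P.layer i, ¬ rel a x := by
    by_contra! hcon
    obtain ⟨_, ⟨c, hc, rfl⟩, _, ⟨d, hd, rfl⟩, hcd⟩ := hi.exists_not_rel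
    obtain ⟨h1, h2⟩ := hcon c hc
    obtain ⟨h3, h4⟩ := hcon d hd
    have hc' := P.coe_mem_layerOne.2 hc
    have hd' := P.coe_mem_layerOne.2 hd
    rcases hcd with hcd | hcd
    · exact hcd ((hi.rRel_mul hc' (.of_mem hu')).trans
        ((h1.symm.trans h3).trans (hi.rRel_mul hd' (.of_mem hu')).symm))
    · exact hcd ((hi.lRel_mul hc' (.of_mem hu')).trans
        ((h2.symm.trans h4).trans (hi.lRel_mul hd' (.of_mem hu')).symm))
  have hx' : IsAbove (P.layerOne i) (x : WithOne S) := .of_mem (P.coe_mem_layerOne.2 hx)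
  by_cases hab : rel a b
  · refine (hadj a x ha hx' hax).reachable.trans (hadj x b hx' hb fun hxb => hax ?_).reachable
    exact ⟨hab.1.trans hxb.1.symm, hab.2.trans hxb.2.symm⟩
  · exact (hadj a b ha hb hab).reachable

-- With connector c in the layer, p * c * q keeps the ℛ-class of p and the ℒ-class of q, so a pair
-- that differs in one of these classes never merges.
omit h in
theorem not_malcevNilpotent_factor : ¬ MalcevNilpotent (P.Factor i) := by
  have := finite_withOne S
  rintro ⟨n, -, hn⟩
  obtain ⟨_, ⟨c, hc, rfl⟩, _, ⟨d, hd, rfl⟩, hcd⟩ := hi.exists_not_rel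
  let T := (P.upper i).toSubsemigroup
  let f := ((P.lower i).restrict T).reesMk
  let X : T × T → Prop := fun p => (p.1 : S) ∈ P.layer i ∧ (p.2 : S) ∈ P.layer i ∧
    (¬ RRel ((p.1 : S) : WithOne S) (p.2 : S) ∨ ¬ LRel ((p.1 : S) : WithOne S) (p.2 : S))
  have hX : ∀ n, X (malcevPair ⟨c, hc.1⟩ ⟨d, hd.1⟩ (fun _ => ((⟨c, hc.1⟩ : T) : WithOne T)) n) := by
    intro n
    induction n with
    | zero => exact ⟨hc, hd, hcd⟩
    | succ n ih =>
      have key : ∀ p q : T, X (p, q) → X (p * ⟨c, hc.1⟩ * q, q * ⟨c, hc.1⟩ * p) := by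
        rintro ⟨p, hp'⟩ ⟨q, hq'⟩ ⟨hp, hq, hpq⟩
        have hR : ∀ y ∈ P.layer i, ∀ z ∈ P.layer i,
            RRel (y : WithOne S) ((y * c * z : S) : WithOne S) := fun y hy z hz => by
          rw [mul_assoc, WithOne.coe_mul]
          exact hi.rRel_mul (P.coe_mem_layerOne.2 hy)
            (.of_mem (P.coe_mem_layerOne.2 (hi.mul_mem_layer hc hz)))
        have hL : ∀ y ∈ P.layer i, ∀ z ∈ P.layer i,
            LRel (z : WithOne S) ((y * c * z : S) : WithOne S) := fun y hy z hz => by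
          rw [WithOne.coe_mul]
          exact hi.lRel_mul (P.coe_mem_layerOne.2 hz)
            (.of_mem (P.coe_mem_layerOne.2 (hi.mul_mem_layer hy hc)))
        exact ⟨hi.mul_mem_layer (hi.mul_mem_layer hp hc) hq,
          hi.mul_mem_layer (hi.mul_mem_layer hq hc) hp,
          hpq.imp (fun h h' => h ((hR p hp q hq).trans (h'.trans (hR q hq p hp).symm)))
            (fun h h' => h ((hL q hq p hp).trans (h'.symm.trans (hL p hp q hq).symm)))⟩
      exact key _ _ ih
  have h1 := hn (f ⟨c, hc.1⟩) (f ⟨d, hd.1⟩)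
    (fun _ => WithOne.mapMulHom f ((⟨c, hc.1⟩ : T) : WithOne T))
  rw [map_malcevPair f ⟨c, hc.1⟩ ⟨d, hd.1⟩ (fun _ => ((⟨c, hc.1⟩ : T) : WithOne T))] at h1
  obtain ⟨h2, -, h3⟩ := hX n
  rcases (SgIdeal.reesMk_eq_iff _).1 h1 with h4 | h4
  · rw [h4] at h3
    exact h3.elim (fun h => h (.refl _)) (fun h => h (.refl _))
  · exact h2.2 h4.1

end IsThick

end PrincipalSeries

/-! ### Edges and roots -/

namespace PrincipalSeries

variable {S : Type u} [Semigroup S] {P : PrincipalSeries S}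

/-- If x were not above the layer, no word involved could contain x; all would be powers of y, or 1,
and the successor would have equal components. -/
theorem isAbove_of_persistent {r : Fin P.length} {x y : S} {Q : Set (WithOne S × WithOne S)}
    (hQ : Persistent (insert 1 ((↑) '' (Subsemigroup.closure ({x, y} : Set S) : Set S))) Q)
    (hQC : ∀ p ∈ Q, p.1 ∈ ((↑) '' (Subsemigroup.closure ({x, y} : Set S) : Set S) : Set (WithOne S))
      ∧ p.2 ∈ ((↑) '' (Subsemigroup.closure ({x, y} : Set S) : Set S) : Set (WithOne S)))
    (hQK : ∀ p ∈ Q, p.1 ∈ P.layerOne r ∧ p.2 ∈ P.layerOne r) (hne : Q.Nonempty) :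
    IsAbove (P.layerOne r) (x : WithOne S) := by
  by_contra hx
  have key : ∀ z ∈ (insert 1 ((↑) '' (Subsemigroup.closure ({x, y} : Set S) : Set S)) :
      Set (WithOne S)), IsAbove (P.layerOne r) z →
      z ∈ (insert 1 ((↑) '' (Subsemigroup.closure ({y} : Set S) : Set S)) : Set (WithOne S)) := by
    rintro _ (rfl | ⟨z, hz, rfl⟩) habove
    · exact Or.inl rfl
    · refine Or.inr ⟨z, ?_, rfl⟩
      induction hz using Subsemigroup.closure_induction with
      | mem z hz =>
        rcases hz with rfl | rfl
        exacts [(hx habove).elim, Subsemigroup.subset_closure rfl]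
      | mul a b _ _ iha ihb =>
        rw [WithOne.coe_mul] at habove
        refine mul_mem (iha ?_) (ihb ?_)
        · exact IsAbove.of_mul_mul (u := 1) (v := b) (by rwa [one_mul])
        · exact IsAbove.of_mul_mul (u := a) (v := 1) (by rwa [mul_one])
  obtain ⟨p, hp⟩ := hne
  obtain ⟨-, w, hw, hnext⟩ := hQ p hp
  obtain ⟨h1, h2⟩ := hQC p hp
  have habove : IsAbove (P.layerOne r) w :=
    IsAbove.of_mul_mul (u := p.1) (v := p.2) (.of_mem (hQK _ hnext).1)
  exact (hQ _ hnext).1 (mul_mul_comm_of_mem_closure (by rintro _ rfl _ rfl; rfl)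
    (key _ (Or.inr h1) (.of_mem (hQK p hp).1)) (key _ (Or.inr h2) (.of_mem (hQK p hp).2))
    (key _ hw habove))

/-- A persistent set of pairs contains a persistent set of pairs in a single layer. -/
theorem exists_persistent_layerOne (P : PrincipalSeries S) {W : Set (WithOne S)}
    {Q : Set (WithOne S × WithOne S)}
    (hQ : Persistent W Q) (hQ1 : ∀ p ∈ Q, p.1 ≠ 1 ∧ p.2 ≠ 1) (hne : Q.Nonempty) :
    ∃ r, ∃ Q' ⊆ Q, Q'.Nonempty ∧ Persistent W Q' ∧
      ∀ p ∈ Q', p.1 ∈ P.layerOne r ∧ p.2 ∈ P.layerOne r := by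
  have hlayer : ∀ z : WithOne S, z ≠ 1 → ∃ j, z ∈ P.layerOne j := by
    intro z hz
    obtain ⟨s, rfl⟩ := WithOne.ne_one_iff_exists.1 hz
    obtain ⟨j, hj⟩ := P.exists_mem_layer s
    exact ⟨j, s, hj, rfl⟩
  let R : Set (Fin P.length) := {j | ∃ p ∈ Q, p.1 ∈ P.layerOne j ∨ p.2 ∈ P.layerOne j}
  -- Multiplication only moves deeper, so once a pair meets the deepest layer that occurs, both
  -- components of its successor lie there.
  obtain ⟨r, ⟨p, hp, hpr⟩, hmax⟩ : ∃ r ∈ R, ∀ j ∈ R, j ≤ r := by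
    obtain ⟨p, hp⟩ := hne
    obtain ⟨j, hj⟩ := hlayer _ (hQ1 p hp).1
    exact Set.exists_max_image R id R.toFinite ⟨j, p, hp, Or.inl hj⟩
  have hmem : ∀ j u a v, a ∈ P.layerOne r → u * a * v ∈ P.layerOne j → r ≤ j := by
    rintro j u _ v ⟨a, ha, rfl⟩ ⟨s, hs, h⟩
    exact P.le_of_mem_layer_of_mem_upper hs ((P.upper r).mem_of_mul_mul_eq ha.1 h.symm)
  have hstep : ∀ p ∈ Q, (p.1 ∈ P.layerOne r ∨ p.2 ∈ P.layerOne r) → ∀ w,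
      (p.1 * w * p.2, p.2 * w * p.1) ∈ Q →
      p.1 * w * p.2 ∈ P.layerOne r ∧ p.2 * w * p.1 ∈ P.layerOne r := by
    intro p hp hpr w hnext
    obtain ⟨j, hj⟩ := hlayer _ (hQ1 _ hnext).1
    obtain ⟨k, hk⟩ := hlayer _ (hQ1 _ hnext).2
    have hjr : j ≤ r := hmax j ⟨_, hnext, Or.inl hj⟩
    have hkr : k ≤ r := hmax k ⟨_, hnext, Or.inr hk⟩
    simp only at hj hk
    have h1 : r ≤ j ∧ r ≤ k := by
      rcases hpr with h | h
      · exact ⟨hmem j 1 _ (w * p.2) h (by simpa only [one_mul, mul_assoc] using hj),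
          hmem k (p.2 * w) _ 1 h (by simpa using hk)⟩
      · exact ⟨hmem j (p.1 * w) _ 1 h (by simpa using hj),
          hmem k 1 _ (w * p.1) h (by simpa only [one_mul, mul_assoc] using hk)⟩
    obtain rfl := le_antisymm hjr h1.1
    obtain rfl := le_antisymm hkr h1.2
    exact ⟨hj, hk⟩
  refine ⟨r, {p ∈ Q | p.1 ∈ P.layerOne r ∧ p.2 ∈ P.layerOne r}, fun p hp => hp.1, ?_, ?_,
    fun p hp => hp.2⟩
  · obtain ⟨-, w, hw, hnext⟩ := hQ p hp
    exact ⟨_, hnext, hstep p hp hpr w hnext⟩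
  · rintro p ⟨hp, hpr⟩
    obtain ⟨h1, w, hw, hnext⟩ := hQ p hp
    exact ⟨h1, w, hw, hnext, hstep p hp (Or.inl hpr.1) w hnext⟩

variable [Finite S] (h : PseudoNilpotent S)

include h

theorem exists_isThick_of_adj (P : PrincipalSeries S) {x y : S}
    (hxy : (upperNonNilpotentGraph S).Adj x y) :
    ∃ r, P.IsThick r ∧ IsAbove (P.layerOne r) (x : WithOne S) ∧
      IsAbove (P.layerOne r) (y : WithOne S) := by
  obtain ⟨Q, hne, hQ, hQC⟩ :=
    exists_persistent_of_adj (SgIdeal.empty S) ((SgIdeal.adj_mk_empty_iff x y).2 hxy)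
  have hQC' : ∀ p ∈ Q, p.1 ∈ ((↑) '' (Subsemigroup.closure ({x, y} : Set S) : Set S) :
      Set (WithOne S)) ∧ p.2 ∈ ((↑) '' (Subsemigroup.closure ({x, y} : Set S) : Set S) :
      Set (WithOne S)) := fun p hp =>
    ⟨Set.image_mono Set.sdiff_subset (hQC p hp).1, Set.image_mono Set.sdiff_subset (hQC p hp).2⟩
  obtain ⟨r, Q', hsub, hne', hQ', hQK⟩ := P.exists_persistent_layerOne hQ (fun p hp => by
    obtain ⟨⟨a, -, ha⟩, b, -, hb⟩ := hQC p hp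
    exact ⟨ha ▸ WithOne.coe_ne_one, hb ▸ WithOne.coe_ne_one⟩) hne
  refine ⟨r, P.isThick_of_persistent h (hQ'.mono (Set.subset_univ _)) hQK hne',
    isAbove_of_persistent hQ' (fun p hp => hQC' p (hsub hp)) hQK hne',
    isAbove_of_persistent (y := x) ?_ ?_ hQK hne'⟩
  · rwa [Set.pair_comm]
  · rw [Set.pair_comm]
    exact fun p hp => hQC' p (hsub hp)

/-- A thick layer fails to be a root only through an edge into the next ideal. That edge lies above
a strictly deeper thick layer, below which one continues; the induction is on the number of layers
left. -/
theorem IsThick.exists_isRoot {r : Fin P.length} (hr : P.IsThick r) :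
    ∃ r', P.IsRoot r' ∧ ∀ s, IsAbove (P.layerOne r) s → IsAbove (P.layerOne r') s := by
  induction hn : P.length - (r : ℕ) using Nat.strong_induction_on generalizing r with
  | _ n ih =>
  by_cases hroot : P.IsRoot r
  · exact ⟨r, hroot, fun _ => id⟩
  obtain ⟨a, ha, b, hb, hab⟩ : ∃ a ∈ P.layer r, ∃ b ∈ (P.lower r).carrier,
      (upperNonNilpotentGraph S).Adj a b := by
    by_contra! hcon
    exact hroot ⟨hr.not_malcevNilpotent_factor, hcon⟩
  obtain ⟨t, ht, hta, htb⟩ := P.exists_isThick_of_adj h hab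
  have hrt : r < t := by
    obtain ⟨u, v, k, hk, huv⟩ := htb
    exact P.lt_of_mem_layer_of_mem_lower hk ((P.lower r).mem_of_mul_mul_eq hb huv.symm)
  obtain ⟨r', hr', hsub⟩ := ih (P.length - t) (by have := t.2; have : (r : ℕ) < t := hrt; omega)
    ht rfl
  refine ⟨r', hr', fun s hs => hsub s ?_⟩
  obtain ⟨u, v, k, hk, huv⟩ := hs
  have := isAbove_of_mem_layer hta ha hk
  rw [huv] at this
  exact this.of_mul_mul

theorem exists_isRoot_of_adj (P : PrincipalSeries S) {x y : S}
    (hxy : (upperNonNilpotentGraph S).Adj x y) :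
    ∃ r, P.IsRoot r ∧ x ∈ P.stem r ∧ y ∈ P.stem r := by
  obtain ⟨t, ht, hx, hy⟩ := P.exists_isThick_of_adj h hxy
  obtain ⟨r, hr, hsub⟩ := ht.exists_isRoot h
  have hthick := IsRoot.isThick P h hr
  exact ⟨r, hr, hthick.mem_stem_iff.2 (hsub _ hx), hthick.mem_stem_iff.2 (hsub _ hy)⟩

/-! ### Connections between stems -/

omit h [Finite S] in
theorem IsThick.layer_subset_stem {i k : Fin P.length} (hi : P.IsThick i) {s : S}
    (hs : s ∈ P.stem i) (hk : s ∈ P.layer k) : P.layer k ⊆ P.stem i := fun _ ht =>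
  hi.mem_stem_iff.2 (isAbove_of_mem_layer (hi.mem_stem_iff.1 hs) hk ht)

omit h [Finite S] in
theorem IsThick.layer_subset_stem_of_subset_F {i j k : Fin P.length} (hi : P.IsThick i)
    (hj : P.layer j ⊆ P.stem i) (hkj : P.layer k ⊆ P.F j) : P.layer k ⊆ P.stem i := by
  intro s hs
  obtain ⟨-, t, ht, hst | hst⟩ := hkj hs
  · have := hi.mem_stem_iff.1 (hj ⟨(P.upper j).mul_mem_left s ht, hst⟩)
    rw [WithOne.coe_mul] at this
    exact hi.mem_stem_iff.2 (IsAbove.of_mul_mul (u := 1) (v := t) (by rwa [one_mul]))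
  · have := hi.mem_stem_iff.1 (hj ⟨(P.upper j).mul_mem_right s ht, hst⟩)
    rw [WithOne.coe_mul] at this
    exact hi.mem_stem_iff.2 (IsAbove.of_mul_mul (u := t) (v := 1) (by rwa [mul_one]))

theorem hasConnection_iff {i j : Fin P.length} (hi : P.IsRoot i) (hj : P.IsRoot j)
    (hij : P.stem i ≠ P.stem j) : P.HasConnection i j ↔ (P.stem i ∩ P.stem j).Nonempty := by
  constructor
  · rintro ⟨k, -, -, -, hk⟩
    exact (P.layer_nonempty k).mono hk
  · rintro ⟨s, hsi, hsj⟩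
    obtain ⟨k, hk⟩ := P.exists_mem_layer s
    exact ⟨k, hi, hj, hij, Set.subset_inter ((IsRoot.isThick P h hi).layer_subset_stem hsi hk)
      ((IsRoot.isThick P h hj).layer_subset_stem hsj hk)⟩

omit h in
theorem IsStrongPseudoNilpotent.hasConnection_trans (hS : P.IsStrongPseudoNilpotent)
    {i₁ i₂ i₃ : Fin P.length} (hne : P.stem i₁ ≠ P.stem i₃) (h₁₂ : P.HasConnection i₁ i₂)
    (h₂₃ : P.HasConnection i₂ i₃) : P.HasConnection i₁ i₃ := by
  obtain ⟨k, hk⟩ := h₁₂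
  obtain ⟨k', hk'⟩ := h₂₃
  have hP := hS.pseudoNilpotent
  have ht₁ := IsRoot.isThick P hP hk.1
  have ht₂ := IsRoot.isThick P hP hk.2.1
  have ht₃ := IsRoot.isThick P hP hk'.2.1
  have hks := Set.subset_inter_iff.1 hk.2.2.2
  have hks' := Set.subset_inter_iff.1 hk'.2.2.2
  obtain ⟨a, ha, c, hc, hac⟩ : ∃ a ∈ P.layer k, ∃ c ∈ P.layer k',
      (upperNonNilpotentGraph S).Adj a c := by
    -- (H1) quantifies over all coordinates and homomorphisms, so it has content only once an actual
    -- one is supplied. At least one of a and b then has a value different from that of c.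
    obtain ⟨G, I, Λ, _, co, Φ, hΦ, hadj⟩ := ht₂.exists_isPseudoNilpotentHom hP
    obtain ⟨a, ha, b, hb, hab⟩ := (hS.h1 _ _ _ hk).2 G I Λ co Φ hΦ
    obtain ⟨c, hc⟩ := P.layer_nonempty k'
    have hadj' : ∀ d ∈ P.layer k, Φ d ≠ Φ c → (upperNonNilpotentGraph S).Adj d c := fun d hd =>
      hadj d c (ht₂.mem_stem_iff.1 (hks.2 hd)) (ht₂.mem_stem_iff.1 (hks'.1 hc))
    by_cases hac : Φ a = Φ c
    · exact ⟨b, hb, c, hc, hadj' b hb fun hbc => hab (hac.trans hbc.symm)⟩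
    · exact ⟨a, ha, c, hc, hadj' a ha hac⟩
  rcases lt_trichotomy k k' with hlt | rfl | hlt
  · exact ⟨k, hk.1, hk'.2.1, hne, Set.subset_inter hks.1
      (ht₃.layer_subset_stem_of_subset_F hks'.2 (hS.h2 k k' hlt ⟨a, ha, c, hc, hac⟩))⟩
  · exact ⟨k, hk.1, hk'.2.1, hne, Set.subset_inter hks.1 hks'.2⟩
  · exact ⟨k', hk.1, hk'.2.1, hne, Set.subset_inter
      (ht₁.layer_subset_stem_of_subset_F hks.1 (hS.h2 k' k hlt ⟨c, hc, a, ha, hac.symm⟩)) hks'.2⟩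

-- Connections are defined only between distinct stems; nonempty intersection also covers coinciding
-- stems, which a path can produce.
omit h in
theorem IsStrongPseudoNilpotent.inter_stem_trans (hS : P.IsStrongPseudoNilpotent)
    {i₁ i₂ i₃ : Fin P.length} (h₁ : P.IsRoot i₁) (h₂ : P.IsRoot i₂) (h₃ : P.IsRoot i₃)
    (h₁₂ : (P.stem i₁ ∩ P.stem i₂).Nonempty) (h₂₃ : (P.stem i₂ ∩ P.stem i₃).Nonempty) :
    (P.stem i₁ ∩ P.stem i₃).Nonempty := by
  have hP := hS.pseudoNilpotent
  by_cases e₁₂ : P.stem i₁ = P.stem i₂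
  · rwa [e₁₂]
  by_cases e₂₃ : P.stem i₂ = P.stem i₃
  · rwa [← e₂₃]
  by_cases e₁₃ : P.stem i₁ = P.stem i₃
  · rw [← e₁₃, Set.inter_self]
    exact h₁₂.mono Set.inter_subset_left
  rw [← hasConnection_iff hP h₁ h₃ e₁₃]
  rw [← hasConnection_iff hP h₁ h₂ e₁₂] at h₁₂
  rw [← hasConnection_iff hP h₂ h₃ e₂₃] at h₂₃
  exact hS.hasConnection_trans e₁₃ h₁₂ h₂₃

-- Each edge of the path lies in the stem of a root, and consecutive such stems share a vertex.
omit h in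
theorem IsStrongPseudoNilpotent.exists_isRoot_of_reachable (hS : P.IsStrongPseudoNilpotent)
    {i : Fin P.length} (hi : P.IsRoot i) {x y : S} (hx : x ∈ P.stem i)
    (hxy : (upperNonNilpotentGraph S).Reachable x y) :
    ∃ r, P.IsRoot r ∧ y ∈ P.stem r ∧ (P.stem i ∩ P.stem r).Nonempty := by
  rw [SimpleGraph.reachable_iff_reflTransGen] at hxy
  induction hxy with
  | refl => exact ⟨i, hi, hx, x, hx, hx⟩
  | tail _ hyz ih =>
    obtain ⟨r, hr, hy, hir⟩ := ih
    obtain ⟨t, ht, hyt, hzt⟩ := P.exists_isRoot_of_adj hS.pseudoNilpotent hyz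
    exact ⟨t, ht, hzt, hS.inter_stem_trans hi hr ht hir ⟨_, hy, hyt⟩⟩

end PrincipalSeries

theorem mainTheorem9 {S : Type u} [Semigroup S] [Finite S] (P : PrincipalSeries S)
    (hS : P.IsStrongPseudoNilpotent) :
    (∀ i₁ i₂ i₃ : Fin P.length, P.stem i₁ ≠ P.stem i₃ →
      P.HasConnection i₁ i₂ → P.HasConnection i₂ i₃ → P.HasConnection i₁ i₃) ∧
    (∀ i j : Fin P.length, P.IsRoot i → P.IsRoot j → P.stem i ≠ P.stem j →
      ¬ P.HasConnection i j →
      ∃ C D : (upperNonNilpotentGraph S).ConnectedComponent,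
        C ≠ D ∧ P.stem i ⊆ C.supp ∧ P.stem j ⊆ D.supp) := by
  refine ⟨fun i₁ i₂ i₃ => hS.hasConnection_trans, fun i j hi hj hij hno => ?_⟩
  have hP := hS.pseudoNilpotent
  rw [PrincipalSeries.hasConnection_iff hP hi hj hij] at hno
  have hstem : ∀ r, P.IsRoot r → ∃ a ∈ P.stem r, P.stem r ⊆
      ((upperNonNilpotentGraph S).connectedComponentMk a).supp := by
    intro r hr
    have ht := PrincipalSeries.IsRoot.isThick P hP hr
    obtain ⟨a, ha⟩ := P.layer_nonempty r
    have ha' := IsAbove.of_mem (P.coe_mem_layerOne.2 ha)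
    refine ⟨a, ht.mem_stem_iff.2 ha', fun b hb => ?_⟩
    exact SimpleGraph.ConnectedComponent.sound (ht.reachable hP (ht.mem_stem_iff.1 hb) ha')
  obtain ⟨a, ha, hC⟩ := hstem i hi
  obtain ⟨b, hb, hD⟩ := hstem j hj
  refine ⟨_, _, fun hCD => hno ?_, hC, hD⟩
  obtain ⟨r, hr, hbr, hir⟩ :=
    hS.exists_isRoot_of_reachable hi ha (SimpleGraph.ConnectedComponent.exact hCD)
  exact hS.inter_stem_trans hi hr hj hir ⟨b, hbr, hb⟩
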